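/- Consider the Helmholtz equation $(\gamma P_x)_x+(\gamma P_y)_y+(\gamma P_z)_z+\gamma\kappa^2P=0$ for $-H\le z\le 0$, with $P=0$ at $z=0$, $P_z=0$ at $z=-H$, and with $P$ and $\gamma(P_z-h_xP_x-h_yP_y)$ continuous across one interface $z=h$. Let $\epsilon>0$, $X=\epsilon x$, $Y=\epsilon^{1/2}y$, and $$\kappa^2=n_0^2(X,z)+\epsilon\nu(X,Y,z),\quad \gamma=\gamma_0(X,z)+\epsilon\gamma_1(X,Y,z),\quad h=h_0(X)+\epsilon h_1(X,Y),$$ where $\gamma_0>0$, $-H<h_0<0$, $\nu$ is complex valued, the other parameters are real, $X$ ranges over an open set, and the parameters are smooth on each side of the interface up to it (continuity in $z$ suffices for $n_0$ and $\nu$). For $f$ piecewise smooth, $f_+$ and $f_-$ denote its limits at $z=h_0$ from above and from below. Let $(k_j^2,\phi_j)$, $j=M,\dots,N$, be eigenpairs, smooth in $X$, with pairwise distinct $k_j>0$ and real $\phi_j$, of $$(\gamma_0\phi_z)_z+\gamma_0n_0^2\phi-\gamma_0k^2\phi=0,\quad \phi|_{z=0}=0,\quad \phi_z|_{z=-H}=0,\quad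 \phi \text{ and } \gamma_0\phi_z \text{ continuous at } z=h_0,\quad \int_{-H}^0\gamma_0\phi^2\,dz=1 .$$ Let $\theta_{j,X}=k_j$, let the resonance condition $|k_l-k_j|<\epsilon$ hold for $M\le j,l\le N$, and take the ansatz $$P=\sum_{j=M}^N\bigl(u_0^{(j)}+\epsilon u_1^{(j)}+\dots\bigr)\exp\Bigl(\frac{\mathrm i}{\epsilon}\theta_j\Bigr),\qquad u_0^{(j)}=A_j(X,Y)\phi_j(X,z).$$ The problem at $O(\epsilon)$ is the boundary value problem in $z$ for $(u_1^{(j)})_{j=M}^N$, with $X,Y$ as parameters, formed by the coefficients of $\epsilon$ (the phase factors being kept as factors): of the Helmholtz equation, summed over $j$, and, for each $j$, of the boundary conditions and of the interface conditions Taylor expanded at $z=h_0$. Put $B_{jl}=\int_{-H}^0\gamma_0u_1^{(j)}\phi_l\,dz$ and $C_{jl}=\int_{-H}^0\gamma_0\phi_{j,X}\phi_l\,dz$. In this problem the components $B_{jl}\phi_l$ of $u_1^{(j)}$, $M\le j,l\le N$, enter the left-hand side of the Helmholtz equation through the resonant terms $(k_l^2-k_j^2)B_{jl}\gamma_0\phi_l\exp(\mathrm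 i\theta_j/\epsilon)$. With the resonant terms omitted, the problem at $O(\epsilon)$ is solvable if and only if, for $l=M,\dots,N$, $$2\mathrm i k_lA_{l,X}+\mathrm i k_{l,X}A_l+A_{l,YY}+\alpha_{ll}A_l+\sum_{j=M,\,j\ne l}^N\alpha_{lj}A_j\exp(\theta_{lj})=0,\qquad \theta_{lj}=\frac{\mathrm i}{\epsilon}(\theta_j-\theta_l),$$ where $$\begin{aligned}\alpha_{lj}={}&\int_{-H}^0\gamma_0\nu\phi_j\phi_l\,dz+\int_{-H}^0\gamma_1(n_0^2-k_j^2)\phi_j\phi_l\,dz-\int_{-H}^0\gamma_1\phi_{jz}\phi_{lz}\,dz-\mathrm i k_j(C_{lj}-C_{jl})\\&+\Bigl\{h_1\phi_l\bigl[((\gamma_0\phi_{jz})_z)_+-((\gamma_0\phi_{jz})_z)_-\bigr]-h_1\gamma_0^2\phi_{jz}\phi_{lz}\Bigl[\Bigl(\frac1{\gamma_0}\Bigr)_+-\Bigl(\frac1{\gamma_0}\Bigr)_-\Bigr]\Bigr\}\Big|_{z=h_0}.\end{aligned}$$ Moreover, for every solution of the full problem at $O(\epsilon)$ the left-hand side of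 the $l$-th equation equals $-\sum_{j\ne l}(k_l^2-k_j^2)B_{jl}\exp(\theta_{lj})$, and is therefore at most $\epsilon\sum_{j\ne l}(k_l+k_j)|B_{jl}|$ in absolute value. -/

import Mathlib

/-! Slow variables `X = ε x`, `Y = ε^{1/2} y`, depth `z ∈ [-H, 0]`, one interface `z = h`. -/

/-- The two sides of the interface: `above` is `h₀ < z < 0`, `below` is `-H < z < h₀`.
A piecewise smooth function is given by its two smooth pieces, indexed by the side; the one-sided
limits `f₊`, `f₋` at the interface are the values there of the pieces `above`, `below`. -/
inductive Side where
  | above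
  | below

/-- Complex fields depending on `(X, Y, z)`. -/
abbrev Fld : Type := ℝ → ℝ → ℝ → ℂ

/-- Formal expansions `f₀ + ε f₁ + ε² f₂ + …` with coefficients depending on `(X, Y, z)`. -/
abbrev Expansion : Type := PowerSeries Fld

/-- The parameters of the waveguide: `h = h₀ + ε h₁`, `γ = γ₀ + ε γ₁`, `κ² = n₀² + ε ν`. -/
structure Waveguide where
  /-- total depth -/
  H : ℝ
  h₀ : ℝ → ℝ
  h₁ : ℝ → ℝ → ℝ
  γ₀ : Side → ℝ → ℝ → ℝ
  γ₁ : Side → ℝ → ℝ → ℝ → ℝ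
  n₀ : Side → ℝ → ℝ → ℝ
  ν : Side → ℝ → ℝ → ℝ → ℂ

noncomputable section

/-! ### Formal multiscale calculus -/

/-- Partial derivatives of a field. -/
def dX (f : Fld) : Fld := fun X Y z => deriv (fun t => f t Y z) X

def dY (f : Fld) : Fld := fun X Y z => deriv (fun t => f X t z) Y

def dZ (f : Fld) : Fld := fun X Y z => deriv (fun t => f X Y t) z

/-- Coefficientwise action of an operator on an expansion. -/
def termwise (D : Fld → Fld) (f : Expansion) : Expansion :=
  PowerSeries.mk fun n => D (PowerSeries.coeff n f)

/-- `∂/∂x` on an amplitude multiplied by the phase factor `exp (i θ(X) / ε)`: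
`∂ₓ (u exp (i θ / ε)) = (i θ_X u + ε u_X) exp (i θ / ε)`. -/
def phaseDx (θ : ℝ → ℝ) (u : Expansion) : Expansion :=
  PowerSeries.C (fun X _ _ => Complex.I * ((deriv θ X : ℝ) : ℂ) : Fld) * u
    + PowerSeries.X * termwise dX u

/-- The Helmholtz operator `(γ P_x)_x + (γ P_y)_y + (γ P_z)_z + γ κ² P` applied to
`P = u exp (i θ / ε)`, the factor `exp (i θ / ε)` being divided out. Since `∂_y = ε^{1/2} ∂_Y`,
the second term is `ε (γ u_Y)_Y`. -/
def helmholtz (γ κsq : Expansion) (θ : ℝ → ℝ) (u : Expansion) : Expansion :=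
  phaseDx θ (γ * phaseDx θ u) + PowerSeries.X * termwise dY (γ * termwise dY u)
    + termwise dZ (γ * termwise dZ u) + γ * κsq * u

namespace Waveguide

variable (W : Waveguide)

/-- `γ = γ₀ + ε γ₁` on the given side. -/
def γ (s : Side) : Expansion :=
  PowerSeries.C (fun X _ z => (W.γ₀ s X z : ℂ) : Fld)
    + PowerSeries.X * PowerSeries.C (fun X Y z => (W.γ₁ s X Y z : ℂ) : Fld)

/-- `κ² = n₀² + ε ν` on the given side. -/
def κsq (s : Side) : Expansion :=
  PowerSeries.C (fun X _ z => ((W.n₀ s X z) ^ 2 : ℂ) : Fld)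
    + PowerSeries.X * PowerSeries.C (W.ν s : Fld)

/-- `h = h₀ + ε h₁`. -/
def h : Expansion :=
  PowerSeries.C (fun X _ _ => (W.h₀ X : ℂ) : Fld)
    + PowerSeries.X * PowerSeries.C (fun X Y _ => (W.h₁ X Y : ℂ) : Fld)

/-- The Taylor expansion in `ε` of the value of `f₀ + ε f₁ + …` at `z = h₀ + ε h₁`. -/
def trace (f : Expansion) : PowerSeries (ℝ → ℝ → ℂ) :=
  PowerSeries.mk fun n X Y => ∑ m ∈ Finset.range (n + 1),
    (W.h₁ X Y : ℂ) ^ m / (m.factorial : ℂ)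
      * iteratedDeriv m (fun z => PowerSeries.coeff (n - m) f X Y z) (W.h₀ X)

/-- `γ (P_z - h_x P_x - h_y P_y)` for `P = u exp (i θ / ε)`, the factor `exp (i θ / ε)` being
divided out; `h_x = ε h_X` and `h_y P_y = ε h_Y u_Y exp (i θ / ε)`. -/
def flux (s : Side) (θ : ℝ → ℝ) (u : Expansion) : Expansion :=
  W.γ s * (termwise dZ u - PowerSeries.X * termwise dX W.h * phaseDx θ u
    - PowerSeries.X * termwise dY W.h * termwise dY u)

/-- The closed layer on the given side of `z = h₀(X)`. -/
def layer (s : Side) (X : ℝ) : Set ℝ :=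
  match s with
  | .above => Set.Icc (W.h₀ X) 0
  | .below => Set.Icc (-W.H) (W.h₀ X)

/-- The open layer on the given side of `z = h₀(X)`. -/
def openLayer (s : Side) (X : ℝ) : Set ℝ :=
  match s with
  | .above => Set.Ioo (W.h₀ X) 0
  | .below => Set.Ioo (-W.H) (W.h₀ X)

/-- `∫_{-H}^0 f dz` for a piecewise given function. -/
def depthIntegral (f : Side → ℝ → ℂ) (X : ℝ) : ℂ :=
  (∫ z in (-W.H)..(W.h₀ X), f .below z) + ∫ z in (W.h₀ X)..0, f .above z

/-- `f₊ - f₋` at `z = h₀(X)`. -/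
def jump (f : Side → ℝ → ℂ) (X : ℝ) : ℂ := f .above (W.h₀ X) - f .below (W.h₀ X)

/-- Standing assumptions on the medium for `X ∈ I`. Near a point of a closed layer the piece of that
layer is a function on a full neighbourhood (smoothness up to and slightly across the boundary). -/
structure Regular (I : Set ℝ) : Prop where
  interface : ∀ X ∈ I, -W.H < W.h₀ X ∧ W.h₀ X < 0
  differentiable_h₀ : ∀ X ∈ I, DifferentiableAt ℝ W.h₀ X
  differentiable_h₁ : ∀ X ∈ I, ∀ Y, DifferentiableAt ℝ (fun p : ℝ × ℝ => W.h₁ p.1 p.2) (X, Y)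
  pos_γ₀ : ∀ s, ∀ X ∈ I, ∀ z ∈ W.layer s X, 0 < W.γ₀ s X z
  smooth_γ₀ : ∀ s, ∀ X ∈ I, ∀ z ∈ W.layer s X,
    ContDiffAt ℝ 1 (fun p : ℝ × ℝ => W.γ₀ s p.1 p.2) (X, z)
  smooth_γ₁ : ∀ s, ∀ X ∈ I, ∀ Y, ∀ z ∈ W.layer s X, ContDiffAt ℝ 1 (W.γ₁ s X Y) z
  continuous_n₀ : ∀ s, ∀ X ∈ I, ∀ z ∈ W.layer s X, ContinuousAt (W.n₀ s X) z
  continuous_ν : ∀ s, ∀ X ∈ I, ∀ Y, ∀ z ∈ W.layer s X, ContinuousAt (W.ν s X Y) z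

/-- `(k², φ)` is an eigenpair, `k > 0`, `φ` real and normalized, of the spectral problem
`(γ₀ φ_z)_z + γ₀ n₀² φ - γ₀ k² φ = 0`, `φ(0) = 0`, `φ_z(-H) = 0`, with `φ` and `γ₀ φ_z` continuous
at `z = h₀`, depending smoothly on `X ∈ I`. -/
structure IsMode (I : Set ℝ) (k : ℝ → ℝ) (φ : Side → ℝ → ℝ → ℝ) : Prop where
  pos : ∀ X ∈ I, 0 < k X
  differentiable_k : ∀ X ∈ I, DifferentiableAt ℝ k X
  smooth : ∀ s, ∀ X ∈ I, ∀ z ∈ W.layer s X, ContDiffAt ℝ 2 (fun p : ℝ × ℝ => φ s p.1 p.2) (X, z)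
  spectral : ∀ s, ∀ X ∈ I, ∀ z ∈ W.openLayer s X,
    deriv (fun t => W.γ₀ s X t * deriv (φ s X) t) z + W.γ₀ s X z * (W.n₀ s X z) ^ 2 * φ s X z
      - W.γ₀ s X z * (k X) ^ 2 * φ s X z = 0
  surface : ∀ X ∈ I, φ .above X 0 = 0
  bottom : ∀ X ∈ I, deriv (φ .below X) (-W.H) = 0
  continuous : ∀ X ∈ I, φ .above X (W.h₀ X) = φ .below X (W.h₀ X)
  continuous_flux : ∀ X ∈ I, W.γ₀ .above X (W.h₀ X) * deriv (φ .above X) (W.h₀ X)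
    = W.γ₀ .below X (W.h₀ X) * deriv (φ .below X) (W.h₀ X)
  normalized : ∀ X ∈ I,
    (∫ z in (-W.H)..(W.h₀ X), W.γ₀ .below X z * φ .below X z ^ 2)
      + (∫ z in (W.h₀ X)..0, W.γ₀ .above X z * φ .above X z ^ 2) = 1

/-! ### The problem at order `ε` -/

/-- The problem at order `ε` for the ansatz `P = ∑_{j ∈ J} u⁽ʲ⁾ exp (i θ_j / ε)`,
`u⁽ʲ⁾ = u₀⁽ʲ⁾ + ε u₁⁽ʲ⁾ + …`, on `X ∈ I`, `Y ∈ ℝ`: the coefficients of `ε` in the Helmholtz equation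
(summed over the phases), in the boundary conditions and in the interface conditions on
`z = h₀ + ε h₁`. The field `r` is the right-hand side of the Helmholtz equation at this order:
`r = 0` is the problem proper. -/
structure SolvesOrderOne (I : Set ℝ) (J : Finset ℕ) (ε : ℝ) (θ : ℕ → ℝ → ℝ) (r : Side → Fld)
    (u : ℕ → Side → Expansion) : Prop where
  smooth : ∀ j ∈ J, ∀ s, ∀ X ∈ I, ∀ Y, ∀ z ∈ W.layer s X,
    ContDiffAt ℝ 2 (PowerSeries.coeff 1 (u j s) X Y) z
  equation : ∀ s, ∀ X ∈ I, ∀ Y, ∀ z ∈ W.openLayer s X,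
    ∑ j ∈ J, PowerSeries.coeff 1 (helmholtz (W.γ s) (W.κsq s) (θ j) (u j s)) X Y z
      * Complex.exp (Complex.I / ε * θ j X) = r s X Y z
  surface : ∀ j ∈ J, ∀ X ∈ I, ∀ Y, PowerSeries.coeff 1 (u j .above) X Y 0 = 0
  bottom : ∀ j ∈ J, ∀ X ∈ I, ∀ Y, PowerSeries.coeff 1 (termwise dZ (u j .below)) X Y (-W.H) = 0
  interface : ∀ j ∈ J, ∀ X ∈ I, ∀ Y,
    PowerSeries.coeff 1 (W.trace (u j .above)) X Y
      = PowerSeries.coeff 1 (W.trace (u j .below)) X Y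
  interface_flux : ∀ j ∈ J, ∀ X ∈ I, ∀ Y,
    PowerSeries.coeff 1 (W.trace (W.flux .above (θ j) (u j .above))) X Y
      = PowerSeries.coeff 1 (W.trace (W.flux .below (θ j) (u j .below))) X Y

/-- The leading terms are `u₀⁽ʲ⁾ = A_j(X, Y) φ_j(X, z)`. -/
def HasLeadingTerm (J : Finset ℕ) (φ : ℕ → Side → ℝ → ℝ → ℝ) (A : ℕ → ℝ → ℝ → ℂ)
    (u : ℕ → Side → Expansion) : Prop :=
  ∀ j ∈ J, ∀ s, PowerSeries.coeff 0 (u j s) = fun X Y z => A j X Y * (φ j s X z : ℂ)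

/-- `B_{jl} = ∫ γ₀ u₁⁽ʲ⁾ φ_l dz`. -/
def B (φ : ℕ → Side → ℝ → ℝ → ℝ) (u : ℕ → Side → Expansion) (j l : ℕ) (X Y : ℝ) : ℂ :=
  W.depthIntegral
    (fun s z => (W.γ₀ s X z : ℂ) * PowerSeries.coeff 1 (u j s) X Y z * (φ l s X z : ℂ)) X

/-- The resonant part of the left-hand side of the Helmholtz equation at order `ε`. The operator
`(γ₀ ∂_z)_z + γ₀ n₀² - γ₀ k_j²` maps the component `B_{jl} φ_l` of `u₁⁽ʲ⁾` to
`(k_l² - k_j²) B_{jl} γ₀ φ_l`; here these terms are collected for `j, l ∈ J`. -/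
def resonantPart (J : Finset ℕ) (ε : ℝ) (θ k : ℕ → ℝ → ℝ) (φ : ℕ → Side → ℝ → ℝ → ℝ)
    (u : ℕ → Side → Expansion) : Side → Fld := fun s X Y z =>
  ∑ j ∈ J, (∑ l ∈ J, ((k l X : ℂ) ^ 2 - (k j X : ℂ) ^ 2) * W.B φ u j l X Y
    * (W.γ₀ s X z : ℂ) * (φ l s X z : ℂ)) * Complex.exp (Complex.I / ε * θ j X)

/-! ### The mode parabolic equations -/

/-- `C_{jl} = ∫ γ₀ φ_{jX} φ_l dz`. -/
def C (φ : ℕ → Side → ℝ → ℝ → ℝ) (j l : ℕ) (X : ℝ) : ℂ :=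
  W.depthIntegral
    (fun s z => (W.γ₀ s X z * deriv (fun t => φ j s t z) X * φ l s X z : ℝ)) X

/-- The coupling coefficient `α_{lj}`. The functions `φ_l`, `γ₀ φ_{jz}`, `γ₀ φ_{lz}` are continuous
at `z = h₀`; their values there are written with the piece `above`. -/
def α (k : ℕ → ℝ → ℝ) (φ : ℕ → Side → ℝ → ℝ → ℝ) (l j : ℕ) (X Y : ℝ) : ℂ :=
  W.depthIntegral (fun s z => (W.γ₀ s X z : ℂ) * W.ν s X Y z * (φ j s X z : ℂ) * (φ l s X z : ℂ)) X
    + W.depthIntegral (fun s z =>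
        (W.γ₁ s X Y z * ((W.n₀ s X z) ^ 2 - (k j X) ^ 2) * φ j s X z * φ l s X z : ℝ)) X
    - W.depthIntegral (fun s z =>
        (W.γ₁ s X Y z * deriv (φ j s X) z * deriv (φ l s X) z : ℝ)) X
    - Complex.I * (k j X : ℂ) * (W.C φ l j X - W.C φ j l X)
    + ((W.h₁ X Y : ℂ) * (φ l .above X (W.h₀ X) : ℂ)
          * W.jump (fun s z => (deriv (fun t => W.γ₀ s X t * deriv (φ j s X) t) z : ℝ)) X
        - (W.h₁ X Y : ℂ) * (W.γ₀ .above X (W.h₀ X) : ℂ) ^ 2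
          * ((deriv (φ j .above X) (W.h₀ X) : ℝ) : ℂ) * ((deriv (φ l .above X) (W.h₀ X) : ℝ) : ℂ)
          * W.jump (fun s z => (1 / W.γ₀ s X z : ℝ)) X)

/-- The left-hand side of the `l`-th mode parabolic equation,
`2 i k_l A_{l,X} + i k_{l,X} A_l + A_{l,YY} + α_{ll} A_l + ∑_{j ≠ l} α_{lj} A_j exp (θ_{lj})`,
`θ_{lj} = (i / ε) (θ_j - θ_l)`. -/
def mpe (J : Finset ℕ) (ε : ℝ) (θ k : ℕ → ℝ → ℝ) (φ : ℕ → Side → ℝ → ℝ → ℝ)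
    (A : ℕ → ℝ → ℝ → ℂ) (l : ℕ) (X Y : ℝ) : ℂ :=
  2 * Complex.I * (k l X : ℂ) * deriv (fun t => A l t Y) X
    + Complex.I * ((deriv (k l) X : ℝ) : ℂ) * A l X Y
    + iteratedDeriv 2 (A l X) Y
    + W.α k φ l l X Y * A l X Y
    + ∑ j ∈ J.erase l, W.α k φ l j X Y * A j X Y
        * Complex.exp (Complex.I / ε * (θ j X - θ l X))

end Waveguide

end

/-! At order `ε` the `j`-th component `u₁` satisfies an inhomogeneous Sturm–Liouville problem in `z`
for `L_j = (γ₀ ∂_z)_z + γ₀ (n₀² - k_j²)`. The leading term `A_j φ_j` supplies the source (`source`)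
and, through the Taylor expanded interface conditions, the jumps of `u₁` (`valueJump`) and of `γ₀
u₁_z` (`fluxJump`).

Necessity is a projection on `φ_l`. Green's identity (`IsMode.green`) turns `L_j u₁` into `(k_l² -
k_j²) B_{jl}` plus interface and surface terms. `depthIntegral_source_mul` identifies the projected
source together with the interface data as the `j`-th contribution to the `l`-th parabolic equation.
The decisive ingredient there is the `X`-derivative of the constant overlap `∫ γ₀ φ_j φ_l`
(`IsMode.deriv_overlap`): it removes the integral of `γ₀_X`, antisymmetrizes the `C` terms, and
produces a moving interface term that cancels the one coming from `h_x P_x`. Summing over `j` with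
the phases (`SolvesOrderOne.projection`), the projected right-hand side equals the resonant sum plus
the left-hand side of the `l`-th equation times its phase. A zero right-hand side gives the identity
and, since the phases have modulus one and `|k_l² - k_j²| ≤ ε (k_l + k_j)`, the bound; for the
resonant part as right-hand side the resonant sums cancel.

Sufficiency needs no Fredholm theory. For each `j` the right-hand side is prescribed as the
combination of the `γ₀ φ_m` with the coupling terms as coefficients. Shooting from the bottom
through the interface (`exists_transmission`) meets every condition except the one at the surface.
Projecting on `φ_j` gives `u₁(0) γ₀(0) φ_{jz}(0) = 0`, and `φ_{jz}(0) ≠ 0` by uniqueness for the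
Cauchy problem, so the surface condition holds as well. Projecting on the other modes shows that the
resonant terms vanish. Summed with the phases, the prescribed right-hand sides collapse to the
parabolic equations times `γ₀ φ_m`, hence to zero. -/

section OneVariable

/-! ### Regularity of functions of one variable and of slices. -/

variable {F : Type*} [NormedAddCommGroup F] [NormedSpace ℝ F] {f : ℝ → F} {z : ℝ}

theorem ContDiffAt.ofReal {n : WithTop ℕ∞} {E : Type*} [NormedAddCommGroup E] [NormedSpace ℝ E]
    {f : E → ℝ} {x : E} (hf : ContDiffAt ℝ n f x) : ContDiffAt ℝ n (fun t => (f t : ℂ)) x :=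
  Complex.ofRealCLM.contDiff.contDiffAt.comp x hf

theorem ContDiffAt.deriv_one (hf : ContDiffAt ℝ 2 f z) : ContDiffAt ℝ 1 (deriv f) z := by
  have h : ContDiffAt ℝ 1 (fderiv ℝ f) z := hf.fderiv_right (by norm_num [one_add_one_eq_two])
  exact h.clm_apply contDiffAt_const

theorem ContDiffAt.continuousAt_deriv (hf : ContDiffAt ℝ 1 f z) : ContinuousAt (deriv f) z := by
  have h : ContDiffAt ℝ 0 (fderiv ℝ f) z := hf.fderiv_right (by norm_num)
  exact (h.clm_apply (contDiffAt_const (c := (1 : ℝ)))).continuousAt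

theorem contDiffAt_two_of_eventually_hasDerivAt {d : ℝ → F}
    (hf : ∀ᶠ t in nhds z, HasDerivAt f (d t) t) (hd : ContDiffAt ℝ 1 d z) :
    ContDiffAt ℝ 2 f z := by
  rw [← one_add_one_eq_two]
  refine (contDiffAt_succ_iff_hasFDerivAt (n := 1)).2
    ⟨fun t => ContinuousLinearMap.toSpanSingleton ℝ (d t), ⟨_, hf, fun t ht => ht.hasFDerivAt⟩, ?_⟩
  exact (ContinuousLinearMap.toSpanSingletonCLE (𝕜 := ℝ) (E := F)).contDiff.contDiffAt.comp z hd

theorem ContDiffAt.slice_right {n : WithTop ℕ∞} {f : ℝ → ℝ → F} {x z : ℝ}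
    (hf : ContDiffAt ℝ n (fun p : ℝ × ℝ => f p.1 p.2) (x, z)) : ContDiffAt ℝ n (f x) z :=
  ContDiffAt.comp (f := fun t : ℝ => (x, t)) z hf (contDiffAt_const.prodMk contDiffAt_id)

theorem ContDiffAt.slice_left {n : WithTop ℕ∞} {f : ℝ → ℝ → F} {x z : ℝ}
    (hf : ContDiffAt ℝ n (fun p : ℝ × ℝ => f p.1 p.2) (x, z)) :
    ContDiffAt ℝ n (fun t => f t z) x :=
  ContDiffAt.comp (f := fun t : ℝ => (t, z)) x hf (contDiffAt_id.prodMk contDiffAt_const)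

/-- The partial derivative in the first variable of a `C¹` function is continuous. -/
theorem ContDiffAt.continuousAt_deriv_left {f : ℝ → ℝ → F} {x z : ℝ}
    (hf : ContDiffAt ℝ 1 (fun p : ℝ × ℝ => f p.1 p.2) (x, z)) :
    ContinuousAt (fun p : ℝ × ℝ => deriv (fun t => f t p.2) p.1) (x, z) := by
  have h : ContDiffAt ℝ 0 (fderiv ℝ fun p : ℝ × ℝ => f p.1 p.2) (x, z) :=
    hf.fderiv_right (by norm_num)
  refine (h.continuousAt.clm_apply (continuousAt_const (y := ((1, 0) : ℝ × ℝ)))).congr ?_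
  filter_upwards [hf.eventually (by simp)] with p hp
  have h1 : HasFDerivAt (fun p : ℝ × ℝ => f p.1 p.2) (fderiv ℝ (fun p : ℝ × ℝ => f p.1 p.2) p) p :=
    (hp.differentiableAt one_ne_zero).hasFDerivAt
  have h2 : HasDerivAt (fun t : ℝ => (t, p.2)) ((1 : ℝ), (0 : ℝ)) p.1 :=
    (hasDerivAt_id _).prodMk (hasDerivAt_const _ _)
  exact (HasFDerivAt.comp_hasDerivAt p.1 h1 h2).deriv.symm

end OneVariable

/-! ### Initial value problems for Sturm–Liouville equations. -/

open Set in
/-- Global solvability of the initial value problem for an ODE whose right-hand side is uniformly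
Lipschitz in the unknown. -/
theorem exists_hasDerivAt_Icc_of_lipschitz {E : Type*} [NormedAddCommGroup E] [NormedSpace ℝ E]
    [CompleteSpace E] {a b : ℝ} (hab : a ≤ b) {f : ℝ → E → E} {K : ℝ} (hK : 0 < K)
    (hf : Continuous fun p : ℝ × E => f p.1 p.2)
    (hL : ∀ t, ∀ y₁ y₂, ‖f t y₁ - f t y₂‖ ≤ K * ‖y₁ - y₂‖) (y₀ : E) :
    ∃ y : ℝ → E, y a = y₀ ∧ ContDiff ℝ 1 y ∧ ∀ t ∈ Icc a b, HasDerivAt y (f t (y t)) t := by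
  -- Picard iteration in a weighted sup norm: the unknown is `v = y / wt`. Since `∫ K wt = (wt - 1)
  -- / 2`, the rate `2 K` makes the map a contraction with constant `1 / 2` on an interval of any
  -- length.
  let wt : ℝ → ℝ := fun s => Real.exp (2 * K * (s - a))
  have hwt : Continuous wt := by fun_prop
  let F : C(Icc a b, E) → ℝ → E := fun v s => f s (wt s • v (projIcc a b hab s))
  have hF : ∀ v, Continuous (F v) := fun v => hf.comp
    (continuous_id.prodMk (hwt.smul (v.continuous.comp continuous_projIcc)))
  let S : C(Icc a b, E) → ℝ → E := fun v t => y₀ + ∫ s in a..t, F v s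
  have hS' : ∀ v t, HasDerivAt (S v) (F v t) t := fun v t =>
    (intervalIntegral.integral_hasDerivAt_right ((hF v).intervalIntegrable _ _)
      ((hF v).stronglyMeasurableAtFilter _ _) (hF v).continuousAt).const_add y₀
  have hS : ∀ v, Continuous (S v) := fun v =>
    continuous_iff_continuousAt.2 fun t => (hS' v t).continuousAt
  let T : C(Icc a b, E) → C(Icc a b, E) := fun v =>
    ⟨fun t => (wt t)⁻¹ • S v t, by
      refine Continuous.smul ?_ ((hS v).comp continuous_subtype_val)
      exact (hwt.comp continuous_subtype_val).inv₀ fun t => (Real.exp_pos _).ne'⟩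
  have hT : ContractingWith (1 / 2) T := by
    refine ⟨by norm_num, LipschitzWith.of_dist_le_mul fun v w => ?_⟩
    rw [ContinuousMap.dist_le (by positivity)]
    rintro ⟨t, ht⟩
    have h1 : ‖∫ s in a..t, (F v s - F w s)‖ ≤ ∫ s in a..t, K * wt s * dist v w := by
      refine intervalIntegral.norm_integral_le_of_norm_le ht.1 ?_
        ((by fun_prop : Continuous fun s => K * wt s * dist v w).intervalIntegrable _ _)
      refine Filter.Eventually.of_forall fun s _ => ?_
      refine (hL _ _ _).trans ?_
      rw [← smul_sub, norm_smul, Real.norm_of_nonneg (Real.exp_pos _).le, mul_assoc K,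
        ← dist_eq_norm]
      exact mul_le_mul_of_nonneg_left (mul_le_mul_of_nonneg_left
        (ContinuousMap.dist_apply_le_dist (f := v) (g := w) _) (Real.exp_pos _).le) hK.le
    have h2 : ∫ s in a..t, K * wt s * dist v w = (wt t - 1) / 2 * dist v w := by
      have hd : ∀ s ∈ uIcc a t,
          HasDerivAt (fun s => wt s / 2 * dist v w) (K * wt s * dist v w) s := by
        intro s _
        have h := (((((hasDerivAt_id s).sub_const a).const_mul (2 * K)).exp).div_const 2).mul_const
          (dist v w)
        refine h.congr_deriv ?_
        simp only [wt, id]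
        ring
      rw [intervalIntegral.integral_eq_sub_of_hasDerivAt hd
        ((by fun_prop : Continuous fun s => K * wt s * dist v w).intervalIntegrable _ _)]
      simp [wt]
      ring
    have h3 : S v t - S w t = ∫ s in a..t, (F v s - F w s) := by
      rw [intervalIntegral.integral_sub ((hF v).intervalIntegrable _ _)
        ((hF w).intervalIntegrable _ _)]
      simp [S]
    have hpos : 0 < wt t := Real.exp_pos _
    change dist ((wt t)⁻¹ • S v t) ((wt t)⁻¹ • S w t) ≤ _
    rw [dist_eq_norm, ← smul_sub, norm_smul, h3, norm_inv, Real.norm_of_nonneg hpos.le]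
    calc (wt t)⁻¹ * ‖∫ s in a..t, (F v s - F w s)‖
        ≤ (wt t)⁻¹ * ((wt t - 1) / 2 * dist v w) := by
          gcongr
          exact h1.trans_eq h2
      _ ≤ (wt t)⁻¹ * (wt t / 2 * dist v w) := by
          gcongr
          linarith
      _ = ((1 / 2 : NNReal) : ℝ) * dist v w := by
          push_cast
          field_simp
  obtain ⟨v, hv⟩ : ∃ v, T v = v := ⟨_, hT.fixedPoint_isFixedPt⟩
  refine ⟨S v, by simp [S], ?_, fun t ht => ?_⟩
  · rw [contDiff_one_iff_deriv]
    exact ⟨fun t => (hS' v t).differentiableAt, by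
      rw [show deriv (S v) = F v from funext fun t => (hS' v t).deriv]; exact hF v⟩
  · have hvt : wt t • v ⟨t, ht⟩ = S v t := by
      conv_lhs => rw [← hv]
      exact smul_inv_smul₀ (Real.exp_pos _).ne' _
    have := hS' v t
    simpa only [F, projIcc_of_mem hab ht, hvt] using this

open Set in
/-- A continuous function on a compact interval extends continuously, with the same bound. -/
theorem exists_continuous_eqOn_Icc {E : Type*} [NormedAddCommGroup E] {a b : ℝ} (hab : a ≤ b)
    {g : ℝ → E} (hg : ContinuousOn g (Icc a b)) :
    ∃ G : ℝ → E, Continuous G ∧ EqOn G g (Icc a b) ∧ ∃ K, 0 < K ∧ ∀ t, ‖G t‖ ≤ K := by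
  refine ⟨IccExtend hab (fun t : Icc a b => g t), hg.domRestrict.Icc_extend', fun t ht => ?_, ?_⟩
  · rw [IccExtend_of_mem _ _ ht]
  · obtain ⟨K, hK⟩ := isCompact_Icc.exists_bound_of_continuousOn hg
    exact ⟨max K 1, by positivity, fun t => (hK _ (projIcc a b hab t).2).trans (le_max_left _ _)⟩

open Set in
/-- The initial value problem `(γ u')' + q u = g`, `u(a) = u₀`, `γ(a) u'(a) = p₀` on `[a, b]`. -/
theorem exists_sturmLiouville_initialValue {a b : ℝ} (hab : a ≤ b) {γ q : ℝ → ℝ} {g : ℝ → ℂ}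
    (hγ : ∀ z ∈ Icc a b, ContDiffAt ℝ 1 γ z) (hpos : ∀ z ∈ Icc a b, 0 < γ z)
    (hq : ContinuousOn q (Icc a b)) (hg : ContinuousOn g (Icc a b)) (u₀ p₀ : ℂ) :
    ∃ u : ℝ → ℂ, (∀ z ∈ Icc a b, ContDiffAt ℝ 2 u z) ∧ u a = u₀ ∧ γ a * deriv u a = p₀ ∧
      ∀ z ∈ Icc a b, deriv (fun t => (γ t : ℂ) * deriv u t) z + q z * u z = g z := by
  have hγc : ContinuousOn γ (Icc a b) := fun z hz => (hγ z hz).continuousAt.continuousWithinAt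
  have hw : ContinuousOn (fun z => ((γ z)⁻¹ : ℝ)) (Icc a b) :=
    hγc.inv₀ fun z hz => (hpos z hz).ne'
  obtain ⟨w, hwc, hwe, Kw, hKw, hwb⟩ := exists_continuous_eqOn_Icc hab hw
  obtain ⟨Q, hQc, hQe, KQ, hKQ, hQb⟩ := exists_continuous_eqOn_Icc hab hq
  obtain ⟨G, hGc, hGe, -⟩ := exists_continuous_eqOn_Icc hab hg
  -- The first-order system for the pair `(u, γ u')`. Its coefficients `1 / γ` and `q` are extended
  -- boundedly to all of `ℝ`, which makes it globally Lipschitz.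
  obtain ⟨y, hya, hyc, hy⟩ := exists_hasDerivAt_Icc_of_lipschitz hab
    (f := fun t (y : ℂ × ℂ) => ((w t : ℂ) * y.2, G t - (Q t : ℂ) * y.1)) (K := max Kw KQ)
    (by positivity) (by fun_prop) (fun t y₁ y₂ => by
      rw [Prod.mk_sub_mk, Prod.norm_mk, ← mul_sub,
        show G t - (Q t : ℂ) * y₁.1 - (G t - (Q t : ℂ) * y₂.1) = -((Q t : ℂ) * (y₁.1 - y₂.1)) by ring,
        norm_neg, norm_mul, norm_mul, Complex.norm_real, Complex.norm_real]
      refine max_le ?_ ?_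
      · gcongr
        · exact (hwb t).trans (le_max_left _ _)
        · exact norm_snd_le (y₁ - y₂)
      · gcongr
        · exact (hQb t).trans (le_max_right _ _)
        · exact norm_fst_le (y₁ - y₂)) (u₀, p₀)
  have hp : ContDiff ℝ 1 fun t => (y t).2 := contDiff_snd.comp hyc
  have hy1 : ContDiff ℝ 1 fun t => (y t).1 := contDiff_fst.comp hyc
  -- the quotient `p / γ` is continuous near `[a, b]`
  let d : ℝ → ℂ := fun t => (y t).2 * (((γ t)⁻¹ : ℝ) : ℂ)
  have hd : ∀ z ∈ Icc a b, ContDiffAt ℝ 1 d z := fun z hz =>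
    hp.contDiffAt.mul ((hγ z hz).inv (hpos z hz).ne').ofReal
  have hdc : ContinuousOn d (Icc a b) := fun z hz => (hd z hz).continuousAt.continuousWithinAt
  have hdy : ∀ z ∈ Icc a b, HasDerivAt (fun t => (y t).1) (d z) z := fun z hz => by
    have h := (hasFDerivAt_fst.comp_hasDerivAt z (hy z hz))
    refine h.congr_deriv ?_
    simp [d, hwe hz, mul_comm]
  have hdp : ∀ z ∈ Icc a b, HasDerivAt (fun t => (y t).2) (g z - q z * (y z).1) z := fun z hz => by
    have h := (hasFDerivAt_snd.comp_hasDerivAt z (hy z hz))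
    refine h.congr_deriv ?_
    simp [hQe hz, hGe hz]
  -- The first component of `y` solves the system with the extended coefficients and need not be
  -- twice differentiable across the endpoints. Integrating `p / γ` with the true `γ`, which is `C¹`
  -- near each endpoint, agrees with it on `[a, b]` and is `C²` on full neighbourhoods.
  let u : ℝ → ℂ := fun z => u₀ + ∫ t in a..z, d t
  have huy : ∀ z ∈ Icc a b, u z = (y z).1 := fun z hz => by
    have h := intervalIntegral.integral_eq_sub_of_hasDerivAt (a := a) (b := z)
      (fun t ht => hdy t ?_) (ContinuousOn.intervalIntegrable ?_)
    · simp [u, h, hya]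
    · rw [uIcc_of_le hz.1] at ht
      exact ⟨ht.1, ht.2.trans hz.2⟩
    · rw [uIcc_of_le hz.1]
      exact hdc.mono (Icc_subset_Icc_right hz.2)
  have hdev : ∀ z ∈ Icc a b, ∀ᶠ t in nhds z, HasDerivAt u (d t) t := by
    intro z hz
    obtain ⟨r, hr, hball⟩ := Metric.eventually_nhds_iff_ball.1 ((hd z hz).eventually (by simp))
    filter_upwards [Metric.ball_mem_nhds z hr] with t ht
    have hzt : IntervalIntegrable d MeasureTheory.volume z t :=
      ContinuousOn.intervalIntegrable fun s hs => (hball s ((convex_ball z r).ordConnected.uIcc_subset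
        (Metric.mem_ball_self hr) ht hs)).continuousAt.continuousWithinAt
    have haz : IntervalIntegrable d MeasureTheory.volume a z :=
      (hdc.mono (Icc_subset_Icc_right hz.2)).intervalIntegrable_of_Icc hz.1
    have hm : StronglyMeasurableAtFilter d (nhds t) MeasureTheory.volume :=
      ContinuousOn.stronglyMeasurableAtFilter Metric.isOpen_ball
        (fun s hs => (hball s hs).continuousAt.continuousWithinAt) t ht
    exact (intervalIntegral.integral_hasDerivAt_right (haz.trans hzt) hm
      (hball t ht).continuousAt).const_add u₀
  have hγ0 : ∀ z ∈ Icc a b, ∀ᶠ t in nhds z, (γ t : ℂ) * deriv u t = (y t).2 := by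
    intro z hz
    filter_upwards [hdev z hz, (hγ z hz).continuousAt.eventually_ne (hpos z hz).ne'] with t h1 h2
    rw [h1.deriv]
    have h3 : (γ t : ℂ) ≠ 0 := Complex.ofReal_ne_zero.2 h2
    simp only [d, Complex.ofReal_inv]
    field_simp
  refine ⟨u, fun z hz => contDiffAt_two_of_eventually_hasDerivAt (hdev z hz) (hd z hz), by simp [u], ?_, fun z hz => ?_⟩
  · rw [(hγ0 a (left_mem_Icc.2 hab)).self_of_nhds, hya]
  · rw [Filter.EventuallyEq.deriv_eq (hγ0 z hz), (hdp z hz).deriv, huy z hz]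
    ring

open Set in
/-- A function with vanishing Cauchy data at an endpoint of `[a, b]` that solves
`(γ φ')' + q φ = 0` vanishes on `[a, b]`. -/
theorem eqOn_zero_of_sturmLiouville {a b : ℝ} {γ q φ : ℝ → ℝ}
    (hγ : ∀ z ∈ Icc a b, ContDiffAt ℝ 1 γ z) (hpos : ∀ z ∈ Icc a b, 0 < γ z)
    (hq : ContinuousOn q (Icc a b)) (hφ : ∀ z ∈ Icc a b, ContDiffAt ℝ 2 φ z)
    (heq : ∀ z ∈ Icc a b, deriv (fun t => γ t * deriv φ t) z + q z * φ z = 0)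
    {c : ℝ} (hc : c = a ∨ c = b) (h0 : φ c = 0) (h1 : deriv φ c = 0) :
    ∀ z ∈ Icc a b, φ z = 0 := by
  have hγc : ContinuousOn γ (Icc a b) := fun z hz => (hγ z hz).continuousAt.continuousWithinAt
  obtain ⟨Kw, hKw⟩ := isCompact_Icc.exists_bound_of_continuousOn
    (hγc.inv₀ fun z hz => (hpos z hz).ne')
  obtain ⟨KQ, hKQ⟩ := isCompact_Icc.exists_bound_of_continuousOn hq
  let y : ℝ → ℝ × ℝ := fun t => (φ t, γ t * deriv φ t)
  let y' : ℝ → ℝ × ℝ := fun t => (deriv φ t, -(q t * φ t))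
  have hy : ∀ z ∈ Icc a b, HasDerivAt y (y' z) z := fun z hz => by
    refine ((hφ z hz).differentiableAt two_ne_zero).hasDerivAt.prodMk ?_
    have h := (((hγ z hz).mul (hφ z hz).deriv_one).differentiableAt one_ne_zero).hasDerivAt
    refine h.congr_deriv ?_
    have := heq z hz
    change deriv (fun t => γ t * deriv φ t) z = _
    linarith
  -- On the compact interval `1 / γ` and `q` are bounded, so `(φ, γ φ')` obeys `‖y'‖ ≤ K ‖y‖` and
  -- Grönwall's inequality applies.
  have hb : ∀ z ∈ Icc a b, ‖y' z‖ ≤ max Kw KQ * ‖y z‖ := fun z hz => by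
    have hne := (hpos z hz).ne'
    have e : deriv φ z = (γ z)⁻¹ * (γ z * deriv φ z) := by field_simp
    refine max_le ?_ ?_
    · change ‖deriv φ z‖ ≤ _
      rw [e, norm_mul]
      exact mul_le_mul ((hKw z hz).trans (le_max_left _ _)) (norm_snd_le (y z)) (norm_nonneg _)
        ((norm_nonneg _).trans ((hKw z hz).trans (le_max_left _ _)))
    · change ‖-(q z * φ z)‖ ≤ _
      rw [norm_neg, norm_mul]
      exact mul_le_mul ((hKQ z hz).trans (le_max_right _ _)) (norm_fst_le (y z)) (norm_nonneg _)
        ((norm_nonneg _).trans ((hKQ z hz).trans (le_max_right _ _)))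
  have hyc : y c = 0 := by simp [y, h0, h1]
  intro z hz
  suffices y z = 0 from congrArg Prod.fst this
  rcases hc with rfl | rfl
  · exact eq_zero_of_abs_deriv_le_mul_abs_self_of_eq_zero_right
      (fun t ht => (hy t ht).continuousAt.continuousWithinAt)
      (fun t ht => (hy t (Ico_subset_Icc_self ht)).hasDerivWithinAt) hyc
      (fun t ht => hb t (Ico_subset_Icc_self ht)) z hz
  · have hm : ∀ t ∈ Icc (-c) (-a), -t ∈ Icc a c := fun t ht =>
      ⟨by linarith [ht.2], by linarith [ht.1]⟩
    have hd : ∀ t ∈ Icc (-c) (-a), HasDerivAt (fun s => y (-s)) (-y' (-t)) t := fun t ht => by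
      have h := (hy _ (hm t ht)).scomp t (hasDerivAt_neg t)
      rw [neg_one_smul] at h
      exact h
    have := eq_zero_of_abs_deriv_le_mul_abs_self_of_eq_zero_right
      (fun t ht => (hd t ht).continuousAt.continuousWithinAt)
      (fun t ht => (hd t (Ico_subset_Icc_self ht)).hasDerivWithinAt) (by simpa using hyc)
      (fun t ht => by rw [norm_neg]; exact hb _ (hm t (Ico_subset_Icc_self ht))) (-z)
      ⟨by linarith [hz.2], by linarith [hz.1]⟩
    simpa using this

/-! ### Leibniz rule with a moving endpoint. -/

section MovingBoundary

open Set Filter Topology intervalIntegral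

/-- Differentiation of `∫_a^{b(x)} f(x, z) dz`. -/
theorem hasDerivAt_integral_of_contDiffAt {f : ℝ → ℝ → ℝ} {b : ℝ → ℝ} {a x₀ : ℝ}
    (hf : ∀ z ∈ uIcc a (b x₀), ContDiffAt ℝ 1 (fun p : ℝ × ℝ => f p.1 p.2) (x₀, z))
    (hb : DifferentiableAt ℝ b x₀) :
    HasDerivAt (fun x => ∫ z in a..b x, f x z)
      ((∫ z in a..b x₀, deriv (fun t => f t z) x₀) + deriv b x₀ * f x₀ (b x₀)) x₀ := by
  let f' : ℝ → ℝ → ℝ := fun x z => deriv (fun t => f t z) x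
  have hf'c : ∀ z ∈ uIcc a (b x₀), ContinuousAt (fun p : ℝ × ℝ => f' p.1 p.2) (x₀, z) :=
    fun z hz => (hf z hz).continuousAt_deriv_left
  have hf'x₀ : ContinuousOn (f' x₀) (uIcc a (b x₀)) := fun z hz =>
    (ContinuousAt.comp (f := fun t : ℝ => (x₀, t)) (hf'c z hz) (by fun_prop)).continuousWithinAt
  obtain ⟨M, hM⟩ := isCompact_uIcc.exists_bound_of_continuousOn hf'x₀
  -- Compactness makes the neighbourhood of `x₀` uniform in `z`; `M + 1` then serves as the
  -- dominating constant.
  have hev : ∀ᶠ x in 𝓝 x₀, ∀ z ∈ uIcc a (b x₀),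
      ContDiffAt ℝ 1 (fun p : ℝ × ℝ => f p.1 p.2) (x, z) ∧ ‖f' x z‖ ≤ M + 1 := by
    refine isCompact_uIcc.eventually_forall_of_forall_eventually fun z hz => ?_
    refine ((hf z hz).eventually (by simp)).and ?_
    have h : ‖f' x₀ z‖ < M + 1 := (hM z hz).trans_lt (lt_add_one M)
    exact ((hf'c z hz).norm.eventually_lt_const h).mono fun p hp => hp.le
  have hslice : ∀ᶠ x in 𝓝 x₀, ContinuousOn (f x) (uIcc a (b x₀)) := hev.mono fun x hx z hz =>
    (hx z hz).1.slice_right.continuousAt.continuousWithinAt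
  -- the fixed interval
  have h1 : HasDerivAt (fun x => ∫ z in a..b x₀, f x z) (∫ z in a..b x₀, f' x₀ z) x₀ := by
    refine (hasDerivAt_integral_of_dominated_loc_of_deriv_le (bound := fun _ => M + 1) hev
      (hslice.mono fun x hx => (intervalIntegrable_iff.1 hx.intervalIntegrable).aestronglyMeasurable)
      hslice.self_of_nhds.intervalIntegrable (intervalIntegrable_iff.1 hf'x₀.intervalIntegrable).aestronglyMeasurable
      ?_ intervalIntegrable_const ?_).2
    · exact Eventually.of_forall fun z hz x hx => (hx z (uIoc_subset_uIcc hz)).2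
    · exact Eventually.of_forall fun z hz x hx =>
        ((hx z (uIoc_subset_uIcc hz)).1.slice_left.differentiableAt one_ne_zero).hasDerivAt
  -- the moving end
  have hcb : ContDiffAt ℝ 1 (fun p : ℝ × ℝ => f p.1 p.2) (x₀, b x₀) := hf _ right_mem_uIcc
  have hnear : ∀ P : ℝ × ℝ → Prop, (∀ᶠ p in 𝓝 (x₀, b x₀), P p) →
      ∀ᶠ x in 𝓝 x₀, ∀ z ∈ uIcc (b x₀) (b x), P (x, z) := by
    intro P hP
    obtain ⟨r, hr, h⟩ := Metric.eventually_nhds_iff_ball.1 hP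
    filter_upwards [Metric.ball_mem_nhds x₀ hr, hb.continuousAt (Metric.ball_mem_nhds (b x₀) hr)]
      with x hx hbx z hz
    refine h _ (by
      rw [← ball_prod_same]
      exact ⟨hx, (convex_ball (b x₀) r).ordConnected.uIcc_subset (Metric.mem_ball_self hr) hbx hz⟩)
  have hint2 : ∀ᶠ x in 𝓝 x₀, IntervalIntegrable (f x) MeasureTheory.volume (b x₀) (b x) :=
    (hnear _ (hcb.eventually (by simp))).mono fun x hx => ContinuousOn.intervalIntegrable
      fun z hz => (hx z hz).slice_right.continuousAt.continuousWithinAt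
  have h2 : HasDerivAt (fun x => ∫ z in b x₀..b x, f x z) (deriv b x₀ * f x₀ (b x₀)) x₀ := by
    have hlin : HasDerivAt (fun x => (b x - b x₀) * f x₀ (b x₀)) (deriv b x₀ * f x₀ (b x₀)) x₀ :=
      (hb.hasDerivAt.sub_const _).mul_const _
    -- By continuity of `f` at `(x₀, b x₀)` the integrand is eventually below any `c > 0`, so the
    -- integral is `o(b x - b x₀)`, hence `o(x - x₀)`.
    have hrem : HasDerivAt (fun x => ∫ z in b x₀..b x, (f x z - f x₀ (b x₀))) 0 x₀ := by
      rw [hasDerivAt_iff_isLittleO]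
      simp only [integral_same, sub_zero, smul_zero]
      have hO : (fun x => b x - b x₀) =O[𝓝 x₀] fun x => x - x₀ := hb.isBigO_sub
      refine Asymptotics.IsLittleO.trans_isBigO ?_ hO
      refine Asymptotics.isLittleO_iff.2 fun c hc => ?_
      have hcont := hcb.continuousAt
      have := hnear (fun p => ‖f p.1 p.2 - f x₀ (b x₀)‖ < c)
        ((hcont.sub continuousAt_const).norm.eventually_lt_const (by simpa using hc))
      filter_upwards [this] with x hx
      exact norm_integral_le_of_norm_le_const fun z hz => (hx z (uIoc_subset_uIcc hz)).le
    have := hlin.add hrem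
    rw [add_zero] at this
    refine this.congr_of_eventuallyEq ?_
    filter_upwards [hint2] with x hx
    simp only [Pi.add_apply]
    rw [integral_sub hx intervalIntegrable_const, integral_const]
    simp
  refine (h1.add h2).congr_of_eventuallyEq ?_
  filter_upwards [hint2, hslice] with x hx hx'
  exact (integral_add_adjacent_intervals hx'.intervalIntegrable hx).symm

end MovingBoundary

/-! ### Coefficients of the expansions at orders `0` and `1`. -/

noncomputable section

/-- No differentiability is required: taking real parts shows that both sides are differentiable
together, and otherwise both derivatives take the default value zero. -/
theorem deriv_ofReal_comp (f : ℝ → ℝ) (z : ℝ) :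
    deriv (fun t => (f t : ℂ)) z = ((deriv f z : ℝ) : ℂ) := by
  by_cases hf : DifferentiableAt ℝ f z
  · exact hf.hasDerivAt.ofReal_comp.deriv
  · rw [deriv_zero_of_not_differentiableAt hf, deriv_zero_of_not_differentiableAt,
      Complex.ofReal_zero]
    exact fun h => hf (Complex.reCLM.differentiableAt.comp z h)

theorem coeff_termwise (D : Fld → Fld) (f : Expansion) (n : ℕ) :
    PowerSeries.coeff n (termwise D f) = D (PowerSeries.coeff n f) :=
  PowerSeries.coeff_mk _ _

theorem coeff_zero_mul_expansion (f g : Expansion) : PowerSeries.coeff 0 (f * g)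
    = PowerSeries.coeff 0 f * PowerSeries.coeff 0 g := by
  simp only [PowerSeries.coeff_zero_eq_constantCoeff, map_mul]

theorem coeff_one_mul_expansion (f g : Expansion) : PowerSeries.coeff 1 (f * g)
    = PowerSeries.coeff 0 f * PowerSeries.coeff 1 g
      + PowerSeries.coeff 1 f * PowerSeries.coeff 0 g := by
  rw [PowerSeries.coeff_mul, Finset.Nat.antidiagonal_succ]
  simp

theorem coeff_one_X_mul (f : Expansion) :
    PowerSeries.coeff 1 (PowerSeries.X * f) = PowerSeries.coeff 0 f :=
  PowerSeries.coeff_succ_X_mul 0 f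

theorem coeff_zero_phaseDx (θ : ℝ → ℝ) (u : Expansion) :
    PowerSeries.coeff 0 (phaseDx θ u)
      = (fun X _ _ => Complex.I * ((deriv θ X : ℝ) : ℂ) : Fld) * PowerSeries.coeff 0 u := by
  simp [phaseDx]

theorem coeff_one_phaseDx (θ : ℝ → ℝ) (u : Expansion) :
    PowerSeries.coeff 1 (phaseDx θ u)
      = (fun X _ _ => Complex.I * ((deriv θ X : ℝ) : ℂ) : Fld) * PowerSeries.coeff 1 u
        + dX (PowerSeries.coeff 0 u) := by
  rw [phaseDx, map_add, PowerSeries.coeff_C_mul,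
    coeff_one_X_mul, coeff_termwise]

namespace Waveguide
variable (W : Waveguide)

theorem coeff_zero_γ (s : Side) :
    PowerSeries.coeff 0 (W.γ s) = (fun X _ z => (W.γ₀ s X z : ℂ) : Fld) := by
  simp [γ]

theorem coeff_one_γ (s : Side) :
    PowerSeries.coeff 1 (W.γ s) = (fun X Y z => (W.γ₁ s X Y z : ℂ) : Fld) := by
  rw [γ, map_add, coeff_one_X_mul]
  simp [PowerSeries.coeff_C]

theorem coeff_zero_κsq (s : Side) :
    PowerSeries.coeff 0 (W.κsq s) = (fun X _ z => ((W.n₀ s X z) ^ 2 : ℂ) : Fld) := by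
  simp [κsq]

theorem coeff_one_κsq (s : Side) : PowerSeries.coeff 1 (W.κsq s) = (W.ν s : Fld) := by
  rw [κsq, map_add, coeff_one_X_mul]
  simp [PowerSeries.coeff_C]

theorem coeff_zero_h : PowerSeries.coeff 0 W.h = (fun X _ _ => (W.h₀ X : ℂ) : Fld) := by
  simp [h]

/-- Only the first Taylor term in `ε h₁` reaches this order, and it differentiates the leading
coefficient. Applied to `P` and to the flux, it is the origin of the jumps of `φ_z` and `(γ₀
φ_z)_z`. -/
theorem coeff_one_trace (f : Expansion) (X Y : ℝ) :
    PowerSeries.coeff 1 (W.trace f) X Y = PowerSeries.coeff 1 f X Y (W.h₀ X)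
      + W.h₁ X Y * deriv (PowerSeries.coeff 0 f X Y) (W.h₀ X) := by
  simp [trace, Finset.sum_range_succ, iteratedDeriv_one]

theorem coeff_zero_flux (s : Side) (θ : ℝ → ℝ) (u : Expansion) :
    PowerSeries.coeff 0 (W.flux s θ u) =
      (fun X _ z => (W.γ₀ s X z : ℂ) : Fld) * dZ (PowerSeries.coeff 0 u) := by
  simp only [flux, coeff_zero_mul_expansion, coeff_zero_γ, mul_assoc, map_sub,
    PowerSeries.coeff_zero_X_mul, coeff_termwise, sub_zero]

/-- The slope `h_x` is of order `ε`, but the phase makes `P_x` of order one, so `h_x P_x` survives.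
The term `h_y P_y` drops out because `h₀` does not depend on `Y`. -/
theorem coeff_one_flux (s : Side) (θ : ℝ → ℝ) (u : Expansion) {X : ℝ}
    (hX : DifferentiableAt ℝ W.h₀ X) (Y z : ℝ) :
    PowerSeries.coeff 1 (W.flux s θ u) X Y z =
      W.γ₀ s X z * (deriv (PowerSeries.coeff 1 u X Y) z
        - ((deriv W.h₀ X : ℝ) : ℂ) * (Complex.I * ((deriv θ X : ℝ) : ℂ) * PowerSeries.coeff 0 u X Y z))
      + W.γ₁ s X Y z * deriv (PowerSeries.coeff 0 u X Y) z := by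
  have hh : dX (PowerSeries.coeff 0 W.h) X Y z = ((deriv W.h₀ X : ℝ) : ℂ) := by
    rw [coeff_zero_h]
    exact hX.hasDerivAt.ofReal_comp.deriv
  have hh' : dY (PowerSeries.coeff 0 W.h) = 0 := by
    rw [coeff_zero_h]
    funext X Y z
    simp [dY]
  rw [flux, coeff_one_mul_expansion, coeff_zero_γ, coeff_one_γ]
  simp only [mul_assoc (PowerSeries.X : Expansion), map_sub, PowerSeries.coeff_zero_X_mul, coeff_termwise, sub_zero,
    coeff_one_X_mul, coeff_zero_mul_expansion, hh', coeff_zero_phaseDx, zero_mul]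
  simp only [Pi.add_apply, Pi.mul_apply, Pi.sub_apply, hh, dZ]

theorem coeff_one_helmholtz (s : Side) (θ : ℝ → ℝ) (u : Expansion) (X Y z : ℝ) :
    PowerSeries.coeff 1 (helmholtz (W.γ s) (W.κsq s) θ u) X Y z =
      deriv (fun t => (W.γ₀ s X t : ℂ) * deriv (PowerSeries.coeff 1 u X Y) t
          + W.γ₁ s X Y t * deriv (PowerSeries.coeff 0 u X Y) t) z
      + W.γ₀ s X z * ((W.n₀ s X z : ℂ) ^ 2 - ((deriv θ X : ℝ) : ℂ) ^ 2)
          * PowerSeries.coeff 1 u X Y z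
      + (W.γ₀ s X z * W.ν s X Y z
          + W.γ₁ s X Y z * ((W.n₀ s X z : ℂ) ^ 2 - ((deriv θ X : ℝ) : ℂ) ^ 2))
          * PowerSeries.coeff 0 u X Y z
      + deriv (fun t => (W.γ₀ s X z : ℂ) * deriv (fun t => PowerSeries.coeff 0 u X t z) t) Y
      + Complex.I * ((deriv θ X : ℝ) : ℂ) * W.γ₀ s X z
          * deriv (fun t => PowerSeries.coeff 0 u t Y z) X
      + deriv (fun t => (W.γ₀ s t z : ℂ) * (Complex.I * ((deriv θ t : ℝ) : ℂ)
          * PowerSeries.coeff 0 u t Y z)) X := by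
  rw [helmholtz]
  simp only [map_add, coeff_one_phaseDx, coeff_one_X_mul]
  simp only [coeff_one_phaseDx, coeff_one_mul_expansion, coeff_termwise, coeff_zero_γ,
    coeff_one_γ, coeff_zero_κsq, coeff_one_κsq, coeff_zero_phaseDx, coeff_zero_mul_expansion]
  have hI := Complex.I_sq
  simp only [Pi.add_apply, Pi.mul_apply, dX, dY, dZ]
  -- Two phase derivatives give `(i θ_X)² = -θ_X²`, which joins `n₀²`.
  linear_combination ((deriv θ X : ℝ) : ℂ) ^ 2 * (W.γ₀ s X z * PowerSeries.coeff 1 u X Y z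
    + W.γ₁ s X Y z * PowerSeries.coeff 0 u X Y z) * hI

/-- The contribution of the leading term `A φ` to the Helmholtz equation at order `ε`. -/
def source (k : ℝ → ℝ) (φ : Side → ℝ → ℝ → ℝ) (A : ℝ → ℝ → ℂ) (s : Side) (X Y z : ℝ) : ℂ :=
  A X Y * ((deriv (fun t => W.γ₁ s X Y t * deriv (φ s X) t) z : ℝ) : ℂ)
    + A X Y * ((W.γ₁ s X Y z * (W.n₀ s X z ^ 2 - k X ^ 2) * φ s X z : ℝ) : ℂ)
    + A X Y * (W.γ₀ s X z * W.ν s X Y z * φ s X z)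
    + (2 * Complex.I * k X * deriv (fun t => A t Y) X + Complex.I * ((deriv k X : ℝ) : ℂ) * A X Y
        + iteratedDeriv 2 (A X) Y) * ((W.γ₀ s X z * φ s X z : ℝ) : ℂ)
    + Complex.I * k X * A X Y * ((deriv (fun t => W.γ₀ s t z) X * φ s X z : ℝ) : ℂ)
    + 2 * (Complex.I * k X * A X Y) * ((W.γ₀ s X z * deriv (fun t => φ s t z) X : ℝ) : ℂ)

variable {W} in
theorem coeff_one_helmholtz_of_leadingTerm {I : Set ℝ} (hI : IsOpen I) (hW : W.Regular I)
    {k : ℝ → ℝ} {φ : Side → ℝ → ℝ → ℝ} (hφ : W.IsMode I k φ) {θ : ℝ → ℝ}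
    (hθ : ∀ X ∈ I, HasDerivAt θ (k X) X) {A : ℝ → ℝ → ℂ}
    {X : ℝ} (hX : X ∈ I) {Y : ℝ} (hAX : DifferentiableAt ℝ (fun t => A t Y) X)
    {s : Side} {u : Expansion}
    (hu : PowerSeries.coeff 0 u = fun X Y z => A X Y * (φ s X z : ℂ))
    {z : ℝ} (hz : z ∈ W.layer s X) (hu' : ContDiffAt ℝ 2 (PowerSeries.coeff 1 u X Y) z) :
    PowerSeries.coeff 1 (helmholtz (W.γ s) (W.κsq s) θ u) X Y z =
      deriv (fun t => (W.γ₀ s X t : ℂ) * deriv (PowerSeries.coeff 1 u X Y) t) z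
      + ((W.γ₀ s X z * (W.n₀ s X z ^ 2 - k X ^ 2) : ℝ) : ℂ) * PowerSeries.coeff 1 u X Y z
      + W.source k φ A s X Y z := by
  have hγz : ContDiffAt ℝ 1 (W.γ₀ s X) z := (hW.smooth_γ₀ s X hX z hz).slice_right
  have hφz : ContDiffAt ℝ 2 (φ s X) z := (hφ.smooth s X hX z hz).slice_right
  have hγX : DifferentiableAt ℝ (fun t => W.γ₀ s t z) X :=
    (hW.smooth_γ₀ s X hX z hz).slice_left.differentiableAt one_ne_zero
  have hφX : DifferentiableAt ℝ (fun t => φ s t z) X :=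
    (hφ.smooth s X hX z hz).slice_left.differentiableAt two_ne_zero
  -- The equality is needed on a neighbourhood, because `θ_X` is differentiated once more; this is
  -- where openness of `I` enters.
  have hk : deriv θ =ᶠ[nhds X] k := (hI.eventually_mem hX).mono fun t ht => (hθ t ht).deriv
  have e1 : deriv (fun t => (W.γ₀ s X t : ℂ) * deriv (PowerSeries.coeff 1 u X Y) t
      + W.γ₁ s X Y t * deriv (fun z => A X Y * (φ s X z : ℂ)) t) z
      = deriv (fun t => (W.γ₀ s X t : ℂ) * deriv (PowerSeries.coeff 1 u X Y) t) z
        + A X Y * ((deriv (fun t => W.γ₁ s X Y t * deriv (φ s X) t) z : ℝ) : ℂ) := by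
    have h : ∀ t, W.γ₁ s X Y t * deriv (fun z => A X Y * (φ s X z : ℂ)) t
        = A X Y * ((W.γ₁ s X Y t * deriv (φ s X) t : ℝ) : ℂ) := fun t => by
      rw [deriv_const_mul_field, deriv_ofReal_comp]
      push_cast
      ring
    simp only [h]
    rw [deriv_fun_add, deriv_const_mul_field, deriv_ofReal_comp]
    · exact (hγz.ofReal.mul hu'.deriv_one).differentiableAt one_ne_zero
    · exact ((((hW.smooth_γ₁ s X hX Y z hz).mul hφz.deriv_one).ofReal).differentiableAt
        one_ne_zero).const_mul _
  have e2 : deriv (fun t => (W.γ₀ s X z : ℂ) * deriv (fun t => A X t * (φ s X z : ℂ)) t) Y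
      = iteratedDeriv 2 (A X) Y * ((W.γ₀ s X z * φ s X z : ℝ) : ℂ) := by
    rw [deriv_const_mul_field, iteratedDeriv_succ, iteratedDeriv_one]
    have h : ∀ t, deriv (fun t => A X t * (φ s X z : ℂ)) t = deriv (A X) t * (φ s X z : ℂ) :=
      fun t => deriv_mul_const_field _
    rw [show deriv (fun t => A X t * (φ s X z : ℂ)) = fun t => deriv (A X) t * (φ s X z : ℂ) from
      funext h, deriv_mul_const_field]
    push_cast
    ring
  have e3 : deriv (fun t => A t Y * (φ s t z : ℂ)) X
      = deriv (fun t => A t Y) X * φ s X z + A X Y * ((deriv (fun t => φ s t z) X : ℝ) : ℂ) :=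
    (hAX.hasDerivAt.mul hφX.hasDerivAt.ofReal_comp).deriv
  have e4 : deriv (fun t => (W.γ₀ s t z : ℂ) * (Complex.I * ((deriv θ t : ℝ) : ℂ)
      * (A t Y * (φ s t z : ℂ)))) X
      = ((deriv (fun t => W.γ₀ s t z) X : ℝ) : ℂ) * (Complex.I * k X * (A X Y * φ s X z))
        + W.γ₀ s X z * (Complex.I * ((deriv k X : ℝ) : ℂ) * (A X Y * φ s X z)
          + Complex.I * k X * (deriv (fun t => A t Y) X * φ s X z
            + A X Y * ((deriv (fun t => φ s t z) X : ℝ) : ℂ))) := by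
    rw [Filter.EventuallyEq.deriv_eq (f := fun t => (W.γ₀ s t z : ℂ) * (Complex.I * (k t : ℂ)
      * (A t Y * (φ s t z : ℂ)))) (hk.mono fun t ht => by rw [ht])]
    exact (hγX.hasDerivAt.ofReal_comp.mul
      (((hφ.differentiable_k X hX).hasDerivAt.ofReal_comp.const_mul Complex.I).mul
        (hAX.hasDerivAt.mul hφX.hasDerivAt.ofReal_comp))).deriv
  rw [coeff_one_helmholtz, hu, e1, e2, e3, e4, hk.self_of_nhds, source]
  push_cast
  ring

end Waveguide
end

/-! ### Depth integrals and Green's identity. -/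

noncomputable section

namespace Waveguide
variable {W : Waveguide} {X : ℝ}

open Set

section DepthIntegral

theorem openLayer_subset_layer (s : Side) : W.openLayer s X ⊆ W.layer s X := by
  cases s <;> exact Ioo_subset_Icc_self

theorem closure_openLayer (hX : -W.H < W.h₀ X ∧ W.h₀ X < 0) (s : Side) :
    closure (W.openLayer s X) = W.layer s X := by
  cases s
  · exact closure_Ioo hX.2.ne
  · exact closure_Ioo hX.1.ne

theorem bottom_mem_layer (hX : -W.H < W.h₀ X ∧ W.h₀ X < 0) : -W.H ∈ W.layer .below X :=
  left_mem_Icc.2 hX.1.le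

theorem surface_mem_layer (hX : -W.H < W.h₀ X ∧ W.h₀ X < 0) : (0 : ℝ) ∈ W.layer .above X :=
  right_mem_Icc.2 hX.2.le

theorem interface_mem_layer (hX : -W.H < W.h₀ X ∧ W.h₀ X < 0) (s : Side) :
    W.h₀ X ∈ W.layer s X := by
  cases s
  · exact left_mem_Icc.2 hX.2.le
  · exact right_mem_Icc.2 hX.1.le

theorem intervalIntegrable_below (hX : -W.H < W.h₀ X ∧ W.h₀ X < 0) {f : Side → ℝ → ℂ}
    (hf : ∀ s, ContinuousOn (f s) (W.layer s X)) :
    IntervalIntegrable (f .below) MeasureTheory.volume (-W.H) (W.h₀ X) :=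
  (hf .below).intervalIntegrable_of_Icc hX.1.le

theorem intervalIntegrable_above (hX : -W.H < W.h₀ X ∧ W.h₀ X < 0) {f : Side → ℝ → ℂ}
    (hf : ∀ s, ContinuousOn (f s) (W.layer s X)) :
    IntervalIntegrable (f .above) MeasureTheory.volume (W.h₀ X) 0 :=
  (hf .above).intervalIntegrable_of_Icc hX.2.le

theorem depthIntegral_add (hX : -W.H < W.h₀ X ∧ W.h₀ X < 0) {f g : Side → ℝ → ℂ}
    (hf : ∀ s, ContinuousOn (f s) (W.layer s X)) (hg : ∀ s, ContinuousOn (g s) (W.layer s X)) :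
    W.depthIntegral (fun s z => f s z + g s z) X = W.depthIntegral f X + W.depthIntegral g X := by
  simp only [depthIntegral]
  rw [intervalIntegral.integral_add (intervalIntegrable_below hX hf)
      (intervalIntegrable_below hX hg),
    intervalIntegral.integral_add (intervalIntegrable_above hX hf)
      (intervalIntegrable_above hX hg)]
  ring

theorem depthIntegral_sub (hX : -W.H < W.h₀ X ∧ W.h₀ X < 0) {f g : Side → ℝ → ℂ}
    (hf : ∀ s, ContinuousOn (f s) (W.layer s X)) (hg : ∀ s, ContinuousOn (g s) (W.layer s X)) :
    W.depthIntegral (fun s z => f s z - g s z) X = W.depthIntegral f X - W.depthIntegral g X := by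
  simp only [depthIntegral]
  rw [intervalIntegral.integral_sub (intervalIntegrable_below hX hf)
      (intervalIntegrable_below hX hg),
    intervalIntegral.integral_sub (intervalIntegrable_above hX hf)
      (intervalIntegrable_above hX hg)]
  ring

theorem depthIntegral_const_mul (c : ℂ) (f : Side → ℝ → ℂ) :
    W.depthIntegral (fun s z => c * f s z) X = c * W.depthIntegral f X := by
  simp only [depthIntegral, intervalIntegral.integral_const_mul]
  ring

theorem depthIntegral_sum (hX : -W.H < W.h₀ X ∧ W.h₀ X < 0) {ι : Type*} (J : Finset ι)
    {f : ι → Side → ℝ → ℂ} (hf : ∀ i ∈ J, ∀ s, ContinuousOn (f i s) (W.layer s X)) :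
    W.depthIntegral (fun s z => ∑ i ∈ J, f i s z) X = ∑ i ∈ J, W.depthIntegral (f i) X := by
  simp only [depthIntegral]
  rw [intervalIntegral.integral_finsetSum fun i hi => intervalIntegrable_below hX (hf i hi),
    intervalIntegral.integral_finsetSum fun i hi => intervalIntegrable_above hX (hf i hi),
    Finset.sum_add_distrib]

theorem depthIntegral_congr (hX : -W.H < W.h₀ X ∧ W.h₀ X < 0) {f g : Side → ℝ → ℂ}
    (h : ∀ s, ∀ z ∈ W.openLayer s X, f s z = g s z) :
    W.depthIntegral f X = W.depthIntegral g X := by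
  simp only [depthIntegral]
  rw [intervalIntegral.integral_congr_Ioo_of_le hX.1.le fun z hz => h .below z hz,
    intervalIntegral.integral_congr_Ioo_of_le hX.2.le fun z hz => h .above z hz]

/-- Integration by parts across the interface. -/
theorem depthIntegral_deriv_mul (hX : -W.H < W.h₀ X ∧ W.h₀ X < 0) {v : Side → ℝ → ℂ}
    {w : Side → ℝ → ℝ} (hv : ∀ s, ∀ z ∈ W.layer s X, ContDiffAt ℝ 1 (v s) z)
    (hw : ∀ s, ∀ z ∈ W.layer s X, ContDiffAt ℝ 1 (w s) z) :
    W.depthIntegral (fun s z => deriv (v s) z * (w s z : ℂ)) X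
      = v .above 0 * w .above 0 - v .below (-W.H) * w .below (-W.H)
        - W.jump (fun s z => v s z * (w s z : ℂ)) X
        - W.depthIntegral (fun s z => v s z * ((deriv (w s) z : ℝ) : ℂ)) X := by
  have key : ∀ s a b, a ≤ b → Icc a b ⊆ W.layer s X →
      ∫ z in a..b, deriv (v s) z * (w s z : ℂ) = v s b * w s b - v s a * w s a
        - ∫ z in a..b, v s z * ((deriv (w s) z : ℝ) : ℂ) := by
    intro s a b hab hs
    have hv' : ∀ z ∈ uIcc a b, ContDiffAt ℝ 1 (v s) z := fun z hz =>
      hv s z (hs (by rwa [uIcc_of_le hab] at hz))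
    have hw' : ∀ z ∈ uIcc a b, ContDiffAt ℝ 1 (w s) z := fun z hz =>
      hw s z (hs (by rwa [uIcc_of_le hab] at hz))
    have := intervalIntegral.integral_mul_deriv_eq_deriv_mul (a := a) (b := b)
      (u := v s) (v := fun z => (w s z : ℂ)) (u' := deriv (v s))
      (v' := fun z => ((deriv (w s) z : ℝ) : ℂ))
      (fun z hz => ((hv' z hz).differentiableAt one_ne_zero).hasDerivAt)
      (fun z hz => ((hw' z hz).differentiableAt one_ne_zero).hasDerivAt.ofReal_comp)
      (ContinuousOn.intervalIntegrable fun z hz =>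
        (hv' z hz).continuousAt_deriv.continuousWithinAt)
      (ContinuousOn.intervalIntegrable fun z hz =>
        (Complex.continuous_ofReal.continuousAt.comp (hw' z hz).continuousAt_deriv).continuousWithinAt)
    rw [this]
    ring
  simp only [depthIntegral, jump]
  rw [key .below _ _ hX.1.le subset_rfl, key .above _ _ hX.2.le subset_rfl]
  ring

end DepthIntegral

section Regularity

variable {I : Set ℝ} {k : ℝ → ℝ} {φ : Side → ℝ → ℝ → ℝ}

theorem Regular.contDiffAt_γ₀ (hW : W.Regular I) (hX : X ∈ I) (s : Side) :
    ∀ z ∈ W.layer s X, ContDiffAt ℝ 1 (W.γ₀ s X) z := fun z hz =>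
  (hW.smooth_γ₀ s X hX z hz).slice_right

theorem IsMode.contDiffAt (hφ : W.IsMode I k φ) (hX : X ∈ I) (s : Side) :
    ∀ z ∈ W.layer s X, ContDiffAt ℝ 2 (φ s X) z := fun z hz =>
  (hφ.smooth s X hX z hz).slice_right

theorem continuousOn_of_contDiffAt {F : Type*} [NormedAddCommGroup F] [NormedSpace ℝ F]
    {f : ℝ → F} {S : Set ℝ} (hf : ∀ z ∈ S, ContDiffAt ℝ 1 f z) : ContinuousOn f S :=
  fun z hz => (hf z hz).continuousAt.continuousWithinAt

theorem continuousOn_deriv_of_contDiffAt {F : Type*} [NormedAddCommGroup F] [NormedSpace ℝ F]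
    {f : ℝ → F} {S : Set ℝ} (hf : ∀ z ∈ S, ContDiffAt ℝ 1 f z) : ContinuousOn (deriv f) S :=
  fun z hz => (hf z hz).continuousAt_deriv.continuousWithinAt

theorem continuousOn_deriv_left {f : ℝ → ℝ → ℝ} {S : Set ℝ}
    (hf : ∀ z ∈ S, ContDiffAt ℝ 1 (fun p : ℝ × ℝ => f p.1 p.2) (X, z)) :
    ContinuousOn (fun z => deriv (fun t => f t z) X) S := fun z hz =>
  (ContinuousAt.comp (f := fun t : ℝ => (X, t)) (hf z hz).continuousAt_deriv_left
    (by fun_prop)).continuousWithinAt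

theorem Regular.continuousOn_n₀ (hW : W.Regular I) (hX : X ∈ I) (s : Side) :
    ContinuousOn (W.n₀ s X) (W.layer s X) := fun z hz =>
  (hW.continuous_n₀ s X hX z hz).continuousWithinAt

theorem Regular.continuousOn_potential (hW : W.Regular I) (hX : X ∈ I) (κ : ℝ) (s : Side) :
    ContinuousOn (fun z => W.γ₀ s X z * (W.n₀ s X z ^ 2 - κ ^ 2)) (W.layer s X) :=
  (continuousOn_of_contDiffAt (hW.contDiffAt_γ₀ hX s)).mul
    (((hW.continuousOn_n₀ hX s).pow 2).sub continuousOn_const)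

/-- The spectral equation holds up to the boundary of each layer. -/
theorem IsMode.spectral_layer (hW : W.Regular I) (hφ : W.IsMode I k φ) (hX : X ∈ I) (s : Side) :
    ∀ z ∈ W.layer s X, deriv (fun t => W.γ₀ s X t * deriv (φ s X) t) z
      + W.γ₀ s X z * (W.n₀ s X z ^ 2 - k X ^ 2) * φ s X z = 0 := by
  have h : EqOn (fun z => deriv (fun t => W.γ₀ s X t * deriv (φ s X) t) z
      + W.γ₀ s X z * (W.n₀ s X z ^ 2 - k X ^ 2) * φ s X z) (fun _ => 0) (W.openLayer s X) :=
    fun z hz => by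
      have := hφ.spectral s X hX z hz
      dsimp only
      linarith
  refine h.of_subset_closure (ContinuousOn.add ?_ (ContinuousOn.mul ?_ ?_)) continuousOn_const
    (openLayer_subset_layer s) (closure_openLayer (hW.interface X hX) s).ge
  · exact continuousOn_deriv_of_contDiffAt fun z hz =>
      (hW.contDiffAt_γ₀ hX s z hz).mul (hφ.contDiffAt hX s z hz).deriv_one
  · exact hW.continuousOn_potential hX _ s
  · exact continuousOn_of_contDiffAt fun z hz => (hφ.contDiffAt hX s z hz).of_le (by norm_num)

/-- Green's identity for the operator `(γ₀ ∂_z)_z + γ₀ n₀² - γ₀ κ²` against a mode, for a function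
with arbitrary jumps at the interface and arbitrary value at the surface. -/
theorem IsMode.green (hW : W.Regular I) (hφ : W.IsMode I k φ) (hX : X ∈ I) (κ : ℝ)
    {u : Side → ℝ → ℂ} (hu : ∀ s, ∀ z ∈ W.layer s X, ContDiffAt ℝ 2 (u s) z)
    (hbot : deriv (u .below) (-W.H) = 0) :
    W.depthIntegral (fun s z => (deriv (fun t => (W.γ₀ s X t : ℂ) * deriv (u s) t) z
        + ((W.γ₀ s X z * (W.n₀ s X z ^ 2 - κ ^ 2) : ℝ) : ℂ) * u s z) * (φ s X z : ℂ)) X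
      = ((k X : ℂ) ^ 2 - (κ : ℂ) ^ 2)
          * W.depthIntegral (fun s z => (W.γ₀ s X z : ℂ) * u s z * (φ s X z : ℂ)) X
        - φ .above X (W.h₀ X) * W.jump (fun s z => (W.γ₀ s X z : ℂ) * deriv (u s) z) X
        + ((W.γ₀ .above X (W.h₀ X) * deriv (φ .above X) (W.h₀ X) : ℝ) : ℂ) * W.jump u X
        - u .above 0 * ((W.γ₀ .above X 0 * deriv (φ .above X) 0 : ℝ) : ℂ) := by
  have hI := hW.interface X hX
  have hγ := hW.contDiffAt_γ₀ hX
  have hφ2 := hφ.contDiffAt hX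
  have hφ1 : ∀ s, ∀ z ∈ W.layer s X, ContDiffAt ℝ 1 (φ s X) z := fun s z hz =>
    (hφ2 s z hz).of_le (by norm_num)
  have hu1 : ∀ s, ∀ z ∈ W.layer s X, ContDiffAt ℝ 1 (u s) z := fun s z hz =>
    (hu s z hz).of_le (by norm_num)
  have hγu : ∀ s, ∀ z ∈ W.layer s X, ContDiffAt ℝ 1 (fun t => (W.γ₀ s X t : ℂ) * deriv (u s) t) z :=
    fun s z hz => (hγ s z hz).ofReal.mul (hu s z hz).deriv_one
  have hγφ : ∀ s, ∀ z ∈ W.layer s X, ContDiffAt ℝ 1 (fun t => W.γ₀ s X t * deriv (φ s X) t) z :=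
    fun s z hz => (hγ s z hz).mul (hφ2 s z hz).deriv_one
  have cφ : ∀ s, ContinuousOn (fun z => (φ s X z : ℂ)) (W.layer s X) := fun s =>
    continuousOn_of_contDiffAt fun z hz => (hφ1 s z hz).ofReal
  have cu : ∀ s, ContinuousOn (u s) (W.layer s X) := fun s => continuousOn_of_contDiffAt (hu1 s)
  have cγ : ∀ s, ContinuousOn (fun z => (W.γ₀ s X z : ℂ)) (W.layer s X) := fun s =>
    continuousOn_of_contDiffAt fun z hz => (hγ s z hz).ofReal
  -- The two integrations by parts share the integral of `γ₀ u_z φ_z`; subtracting them leaves only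
  -- boundary and interface terms.
  have i1 := depthIntegral_deriv_mul hI hγu hφ1
  have i2 := depthIntegral_deriv_mul hI hu1 hγφ
  have e : W.depthIntegral (fun s z => deriv (u s) z
        * ((W.γ₀ s X z * deriv (φ s X) z : ℝ) : ℂ)) X
      = W.depthIntegral (fun s z => (W.γ₀ s X z : ℂ) * deriv (u s) z
        * ((deriv (φ s X) z : ℝ) : ℂ)) X :=
    depthIntegral_congr hI fun s z _ => by push_cast; ring
  have c1 : ∀ s, ContinuousOn (fun z => deriv (fun t => (W.γ₀ s X t : ℂ) * deriv (u s) t) z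
      * (φ s X z : ℂ)) (W.layer s X) := fun s =>
    (continuousOn_deriv_of_contDiffAt (hγu s)).mul (cφ s)
  have c2 : ∀ s, ContinuousOn (fun z => u s z
      * ((deriv (fun t => W.γ₀ s X t * deriv (φ s X) t) z : ℝ) : ℂ)) (W.layer s X) := fun s =>
    (cu s).mul (Complex.continuous_ofReal.comp_continuousOn
      (continuousOn_deriv_of_contDiffAt (hγφ s)))
  have split : W.depthIntegral (fun s z => (deriv (fun t => (W.γ₀ s X t : ℂ) * deriv (u s) t) z
        + ((W.γ₀ s X z * (W.n₀ s X z ^ 2 - κ ^ 2) : ℝ) : ℂ) * u s z) * (φ s X z : ℂ)) X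
      = W.depthIntegral (fun s z => deriv (fun t => (W.γ₀ s X t : ℂ) * deriv (u s) t) z
          * (φ s X z : ℂ)) X
        - W.depthIntegral (fun s z => u s z
            * ((deriv (fun t => W.γ₀ s X t * deriv (φ s X) t) z : ℝ) : ℂ)) X
        + ((k X : ℂ) ^ 2 - (κ : ℂ) ^ 2)
          * W.depthIntegral (fun s z => (W.γ₀ s X z : ℂ) * u s z * (φ s X z : ℂ)) X := by
    rw [← depthIntegral_const_mul, ← depthIntegral_sub hI, ← depthIntegral_add hI]
    · refine depthIntegral_congr hI fun s z hz => ?_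
      have hs := hφ.spectral_layer hW hX s z (openLayer_subset_layer s hz)
      have hs' : deriv (fun t => W.γ₀ s X t * deriv (φ s X) t) z
        = - (W.γ₀ s X z * (W.n₀ s X z ^ 2 - k X ^ 2) * φ s X z) := by linarith
      rw [hs']
      push_cast
      ring
    · exact fun s => (c1 s).sub (c2 s)
    · exact fun s => continuousOn_const.mul (((cγ s).mul (cu s)).mul (cφ s))
    · exact c1
    · exact c2
  rw [split, i1]
  rw [e] at i2
  have hb := hφ.bottom X hX
  have hs := hφ.surface X hX
  have hc := hφ.continuous X hX
  have hf := hφ.continuous_flux X hX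
  simp only [jump, hb, hs, hbot, ← hc, ← hf] at i2 ⊢
  push_cast at i2 ⊢
  linear_combination -i2

end Regularity

end Waveguide
end

/-! ### Orthogonality of modes, overlap derivatives and the projected source. -/

noncomputable section

namespace Waveguide
variable {W : Waveguide} {X : ℝ} {I : Set ℝ}

open Set

theorem continuousOn_layer_add {f g : Side → ℝ → ℂ} (hf : ∀ s, ContinuousOn (f s) (W.layer s X))
    (hg : ∀ s, ContinuousOn (g s) (W.layer s X)) (s : Side) :
    ContinuousOn (fun z => f s z + g s z) (W.layer s X) :=
  (hf s).add (hg s)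

theorem depthIntegral_ofReal (f : Side → ℝ → ℝ) :
    W.depthIntegral (fun s z => (f s z : ℂ)) X
      = (((∫ z in (-W.H)..(W.h₀ X), f .below z) + ∫ z in (W.h₀ X)..0, f .above z : ℝ) : ℂ) := by
  simp only [depthIntegral, intervalIntegral.integral_ofReal, Complex.ofReal_add]

theorem IsMode.normalized_depthIntegral {k : ℝ → ℝ} {φ : Side → ℝ → ℝ → ℝ}
    (hφ : W.IsMode I k φ) (hX : X ∈ I) :
    W.depthIntegral (fun s z => ((W.γ₀ s X z * φ s X z * φ s X z : ℝ) : ℂ)) X = 1 := by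
  rw [depthIntegral_ofReal (fun s z => W.γ₀ s X z * φ s X z * φ s X z), ← Complex.ofReal_one,
    ← hφ.normalized X hX]
  simp only [mul_assoc, pow_two]

variable {k₁ k₂ : ℝ → ℝ} {φ ψ : Side → ℝ → ℝ → ℝ}

/-- Green's identity for `ψ` with `u = φ` and `κ = k₁`: the left side, both jumps and the surface
term vanish, leaving `(k₂² - k₁²)` times the overlap. Positivity of the wavenumbers makes their
squares distinct. -/
theorem IsMode.orthogonal (hW : W.Regular I) (hφ : W.IsMode I k₁ φ) (hψ : W.IsMode I k₂ ψ)
    (hX : X ∈ I) (hne : k₁ X ≠ k₂ X) :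
    W.depthIntegral (fun s z => ((W.γ₀ s X z * φ s X z * ψ s X z : ℝ) : ℂ)) X = 0 := by
  have hd : ∀ s, deriv (fun t => (φ s X t : ℂ)) = fun t => ((deriv (φ s X) t : ℝ) : ℂ) := fun s =>
    funext fun t => deriv_ofReal_comp _ t
  have h := hψ.green hW hX (k₁ X) (u := fun s z => (φ s X z : ℂ))
    (fun s z hz => (hφ.contDiffAt hX s z hz).ofReal) (by
      rw [hd]
      simp [hφ.bottom X hX])
  have h0 : W.depthIntegral (fun s z => (deriv (fun t => (W.γ₀ s X t : ℂ)
      * deriv (fun z => (φ s X z : ℂ)) t) z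
      + ((W.γ₀ s X z * (W.n₀ s X z ^ 2 - k₁ X ^ 2) : ℝ) : ℂ) * φ s X z) * (ψ s X z : ℂ)) X = 0 := by
    rw [depthIntegral_congr (g := fun _ _ => 0) (hW.interface X hX)]
    · simp [depthIntegral]
    · intro s z hz
      have hs := hφ.spectral_layer hW hX s z (openLayer_subset_layer s hz)
      have hs' : (deriv (fun t => (W.γ₀ s X t : ℂ) * deriv (fun z => (φ s X z : ℂ)) t) z)
          = ((deriv (fun t => W.γ₀ s X t * deriv (φ s X) t) z : ℝ) : ℂ) := by
        rw [hd, ← deriv_ofReal_comp]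
        simp only [Complex.ofReal_mul]
      rw [hs', ← Complex.ofReal_mul, ← Complex.ofReal_add, hs]
      simp
  have j1 : W.jump (fun s z => (W.γ₀ s X z : ℂ) * deriv (fun z => (φ s X z : ℂ)) z) X = 0 := by
    simp only [hd, jump, ← Complex.ofReal_mul, hφ.continuous_flux X hX, sub_self]
  have j2 : W.jump (fun s z => (φ s X z : ℂ)) X = 0 := by
    simp only [jump, hφ.continuous X hX, sub_self]
  rw [h0, j1, j2, hφ.surface X hX] at h
  have hk : (k₂ X : ℂ) ^ 2 - (k₁ X : ℂ) ^ 2 ≠ 0 := by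
    have h1 := hφ.pos X hX
    have h2 := hψ.pos X hX
    rw [← Complex.ofReal_pow, ← Complex.ofReal_pow, ← Complex.ofReal_sub, Complex.ofReal_ne_zero,
      sub_ne_zero]
    exact fun h => hne ((pow_left_inj₀ h2.le h1.le two_ne_zero).1 h).symm
  have h' : ((k₂ X : ℂ) ^ 2 - (k₁ X : ℂ) ^ 2) * W.depthIntegral
      (fun s z => (W.γ₀ s X z : ℂ) * (φ s X z : ℂ) * (ψ s X z : ℂ)) X = 0 := by
    simpa using h.symm
  simpa using (mul_eq_zero.1 h').resolve_left hk

/-- Differentiation in `X` of a constant overlap integral of two modes. -/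
theorem IsMode.deriv_overlap (hI : IsOpen I) (hW : W.Regular I) (hφ : W.IsMode I k₁ φ)
    (hψ : W.IsMode I k₂ ψ) (hX : X ∈ I) {δ : ℂ}
    (hδ : ∀ x ∈ I, W.depthIntegral (fun s z => ((W.γ₀ s x z * φ s x z * ψ s x z : ℝ) : ℂ)) x = δ) :
    W.depthIntegral (fun s z => ((deriv (fun t => W.γ₀ s t z) X * φ s X z * ψ s X z : ℝ) : ℂ)) X
      + W.depthIntegral
          (fun s z => ((W.γ₀ s X z * deriv (fun t => φ s t z) X * ψ s X z : ℝ) : ℂ)) X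
      + W.depthIntegral
          (fun s z => ((W.γ₀ s X z * deriv (fun t => ψ s t z) X * φ s X z : ℝ) : ℂ)) X
      = ((deriv W.h₀ X : ℝ) : ℂ) * (φ .above X (W.h₀ X) : ℂ) * (ψ .above X (W.h₀ X) : ℂ)
          * W.jump (fun s z => (W.γ₀ s X z : ℂ)) X := by
  have hlt := hW.interface X hX
  have hγ := fun s => hW.smooth_γ₀ s X hX
  have hφ1 := fun s z hz => (hφ.smooth s X hX z hz).of_le (m := 1) (by norm_num)
  have hψ1 := fun s z hz => (hψ.smooth s X hX z hz).of_le (m := 1) (by norm_num)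
  let f : Side → ℝ → ℝ → ℝ := fun s x z => W.γ₀ s x z * φ s x z * ψ s x z
  have hf : ∀ s, ∀ z ∈ W.layer s X, ContDiffAt ℝ 1 (fun p : ℝ × ℝ => f s p.1 p.2) (X, z) :=
    fun s z hz => ((hγ s z hz).mul (hφ1 s z hz)).mul (hψ1 s z hz)
  have hfd : ∀ s, ∀ z ∈ W.layer s X, deriv (fun t => f s t z) X
      = deriv (fun t => W.γ₀ s t z) X * φ s X z * ψ s X z
        + W.γ₀ s X z * deriv (fun t => φ s t z) X * ψ s X z
        + W.γ₀ s X z * deriv (fun t => ψ s t z) X * φ s X z := fun s z hz => by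
    have h1 := ((hγ s z hz).slice_left.differentiableAt one_ne_zero).hasDerivAt
    have h2 := ((hφ1 s z hz).slice_left.differentiableAt one_ne_zero).hasDerivAt
    have h3 := ((hψ1 s z hz).slice_left.differentiableAt one_ne_zero).hasDerivAt
    refine ((h1.mul h2).mul h3).deriv.trans ?_
    simp only [Pi.mul_apply]
    ring
  have hb := hasDerivAt_integral_of_contDiffAt (f := f .below) (a := -W.H) (b := W.h₀) (x₀ := X)
    (fun z hz => hf .below z (by rwa [uIcc_of_le hlt.1.le] at hz)) (hW.differentiable_h₀ X hX)
  -- The upper layer is integrated from `0` to `h₀`, so that the moving end is again the upper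
  -- limit; the sign is restored by subtracting.
  have ha := hasDerivAt_integral_of_contDiffAt (f := f .above) (a := 0) (b := W.h₀) (x₀ := X)
    (fun z hz => hf .above z (by rwa [uIcc_of_ge hlt.2.le] at hz)) (hW.differentiable_h₀ X hX)
  have hconst : (fun x => (∫ z in (-W.H)..W.h₀ x, f .below x z) - ∫ z in 0..W.h₀ x, f .above x z)
      =ᶠ[nhds X] fun _ => δ.re := by
    filter_upwards [hI.mem_nhds hX] with x hx
    have h := hδ x hx
    rw [depthIntegral_ofReal (fun s z => W.γ₀ s x z * φ s x z * ψ s x z)] at h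
    rw [← h, Complex.ofReal_re, intervalIntegral.integral_symm (W.h₀ x) 0, sub_neg_eq_add]
  have hzero := (hb.sub ha).unique ((hasDerivAt_const X δ.re).congr_of_eventuallyEq hconst)
  have c1 : ∀ s, ContinuousOn (fun z =>
      ((deriv (fun t => W.γ₀ s t z) X * φ s X z * ψ s X z : ℝ) : ℂ)) (W.layer s X) := fun s =>
    Complex.continuous_ofReal.comp_continuousOn (((continuousOn_deriv_left (hγ s)).mul
      (continuousOn_of_contDiffAt fun z hz => (hφ1 s z hz).slice_right)).mul
      (continuousOn_of_contDiffAt fun z hz => (hψ1 s z hz).slice_right))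
  have c2 : ∀ s, ContinuousOn (fun z =>
      ((W.γ₀ s X z * deriv (fun t => φ s t z) X * ψ s X z : ℝ) : ℂ)) (W.layer s X) := fun s =>
    Complex.continuous_ofReal.comp_continuousOn
      (((continuousOn_of_contDiffAt (hW.contDiffAt_γ₀ hX s)).mul
      (continuousOn_deriv_left (hφ1 s))).mul
      (continuousOn_of_contDiffAt fun z hz => (hψ1 s z hz).slice_right))
  have c3 : ∀ s, ContinuousOn (fun z =>
      ((W.γ₀ s X z * deriv (fun t => ψ s t z) X * φ s X z : ℝ) : ℂ)) (W.layer s X) := fun s =>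
    Complex.continuous_ofReal.comp_continuousOn
      (((continuousOn_of_contDiffAt (hW.contDiffAt_γ₀ hX s)).mul
      (continuousOn_deriv_left (hψ1 s))).mul
      (continuousOn_of_contDiffAt fun z hz => (hφ1 s z hz).slice_right))
  rw [← depthIntegral_add hlt c1 c2, ← depthIntegral_add hlt (continuousOn_layer_add c1 c2) c3,
    depthIntegral_congr (g := fun s z => ((deriv (fun t => f s t z) X : ℝ) : ℂ)) hlt fun s z hz => by
      rw [hfd s z (openLayer_subset_layer s hz)]
      push_cast
      ring,
    depthIntegral_ofReal (fun s z => deriv (fun t => f s t z) X)]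
  rw [intervalIntegral.integral_symm (W.h₀ X) 0] at hzero
  have hφc := hφ.continuous X hX
  have hψc := hψ.continuous X hX
  simp only [jump]
  rw [← Complex.ofReal_sub]
  simp only [← Complex.ofReal_mul]
  congr 1
  simp only [f, ← hφc, ← hψc] at hzero ⊢
  linear_combination hzero

variable (W) in
/-- The jump of `u₁` at `z = h₀` prescribed by the leading term `A φ`. -/
def valueJump (φ : Side → ℝ → ℝ → ℝ) (A : ℝ → ℝ → ℂ) (X Y : ℝ) : ℂ :=
  -(W.h₁ X Y * A X Y * W.jump (fun s z => ((deriv (φ s X) z : ℝ) : ℂ)) X)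

variable (W) in
/-- The jump of `γ₀ u_{1z}` at `z = h₀` prescribed by the leading term `A φ`. -/
def fluxJump (k : ℝ → ℝ) (φ : Side → ℝ → ℝ → ℝ) (A : ℝ → ℝ → ℂ) (X Y : ℝ) : ℂ :=
  Complex.I * k X * ((deriv W.h₀ X : ℝ) : ℂ) * A X Y * φ .above X (W.h₀ X)
      * W.jump (fun s z => (W.γ₀ s X z : ℂ)) X
    - A X Y * W.jump (fun s z => ((W.γ₁ s X Y z * deriv (φ s X) z : ℝ) : ℂ)) X
    - W.h₁ X Y * A X Y * W.jump
        (fun s z => ((deriv (fun t => W.γ₀ s X t * deriv (φ s X) t) z : ℝ) : ℂ)) X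

/-- The projection on `φ_l` of the source generated by `A_j φ_j`, including the contributions of
the interface data, is the `j`-th part of the `l`-th mode parabolic equation. -/
theorem depthIntegral_source_mul (hI : IsOpen I) (hW : W.Regular I) {k : ℕ → ℝ → ℝ}
    {φ : ℕ → Side → ℝ → ℝ → ℝ} {j l : ℕ} (hj : W.IsMode I (k j) (φ j)) (hl : W.IsMode I (k l) (φ l))
    {δ : ℂ} (hδ : ∀ x ∈ I,
      W.depthIntegral (fun s z => ((W.γ₀ s x z * φ j s x z * φ l s x z : ℝ) : ℂ)) x = δ)
    (A : ℝ → ℝ → ℂ) (hX : X ∈ I) (Y : ℝ) :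
    W.depthIntegral (fun s z => W.source (k j) (φ j) A s X Y z * (φ l s X z : ℂ)) X
      - φ l .above X (W.h₀ X) * W.fluxJump (k j) (φ j) A X Y
      + ((W.γ₀ .above X (W.h₀ X) * deriv (φ l .above X) (W.h₀ X) : ℝ) : ℂ)
          * W.valueJump (φ j) A X Y
      = δ * (2 * Complex.I * k j X * deriv (fun t => A t Y) X
          + Complex.I * ((deriv (k j) X : ℝ) : ℂ) * A X Y + iteratedDeriv 2 (A X) Y)
        + W.α k φ l j X Y * A X Y := by
  have hlt := hW.interface X hX
  have cj : ∀ s, ContinuousOn (φ j s X) (W.layer s X) := fun s =>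
    continuousOn_of_contDiffAt fun z hz => (hj.contDiffAt hX s z hz).of_le (by norm_num)
  have cl : ∀ s, ContinuousOn (φ l s X) (W.layer s X) := fun s =>
    continuousOn_of_contDiffAt fun z hz => (hl.contDiffAt hX s z hz).of_le (by norm_num)
  have cγ : ∀ s, ContinuousOn (W.γ₀ s X) (W.layer s X) := fun s =>
    continuousOn_of_contDiffAt (hW.contDiffAt_γ₀ hX s)
  have cγ₁ : ∀ s, ContinuousOn (W.γ₁ s X Y) (W.layer s X) := fun s =>
    continuousOn_of_contDiffAt (hW.smooth_γ₁ s X hX Y)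
  have cν : ∀ s, ContinuousOn (W.ν s X Y) (W.layer s X) := fun s z hz =>
    (hW.continuous_ν s X hX Y z hz).continuousWithinAt
  have cr : ∀ {f : Side → ℝ → ℝ}, (∀ s, ContinuousOn (f s) (W.layer s X)) →
      ∀ s, ContinuousOn (fun z => (f s z : ℂ)) (W.layer s X) := fun hf s =>
    Complex.continuous_ofReal.comp_continuousOn (hf s)
  have hγ₁φ : ∀ s, ∀ z ∈ W.layer s X,
      ContDiffAt ℝ 1 (fun t => W.γ₁ s X Y t * deriv (φ j s X) t) z := fun s z hz =>
    (hW.smooth_γ₁ s X hX Y z hz).mul (hj.contDiffAt hX s z hz).deriv_one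
  -- the six pieces of the source
  let f₁ : Side → ℝ → ℂ := fun s z =>
    ((deriv (fun t => W.γ₁ s X Y t * deriv (φ j s X) t) z : ℝ) : ℂ) * (φ l s X z : ℂ)
  let f₂ : Side → ℝ → ℂ := fun s z =>
    ((W.γ₁ s X Y z * (W.n₀ s X z ^ 2 - k j X ^ 2) * φ j s X z * φ l s X z : ℝ) : ℂ)
  let f₃ : Side → ℝ → ℂ := fun s z =>
    (W.γ₀ s X z : ℂ) * W.ν s X Y z * (φ j s X z : ℂ) * (φ l s X z : ℂ)
  let f₄ : Side → ℝ → ℂ := fun s z => ((W.γ₀ s X z * φ j s X z * φ l s X z : ℝ) : ℂ)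
  let f₅ : Side → ℝ → ℂ := fun s z =>
    ((deriv (fun t => W.γ₀ s t z) X * φ j s X z * φ l s X z : ℝ) : ℂ)
  let f₆ : Side → ℝ → ℂ := fun s z =>
    ((W.γ₀ s X z * deriv (fun t => φ j s t z) X * φ l s X z : ℝ) : ℂ)
  have c₁ : ∀ s, ContinuousOn (f₁ s) (W.layer s X) := fun s =>
    (cr (fun s => continuousOn_deriv_of_contDiffAt (hγ₁φ s)) s).mul (cr cl s)
  have c₂ : ∀ s, ContinuousOn (f₂ s) (W.layer s X) := cr fun s =>
    (((cγ₁ s).mul (((hW.continuousOn_n₀ hX s).pow 2).sub continuousOn_const)).mul (cj s)).mul (cl s)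
  have c₃ : ∀ s, ContinuousOn (f₃ s) (W.layer s X) := fun s =>
    (((cr cγ s).mul (cν s)).mul (cr cj s)).mul (cr cl s)
  have c₄ : ∀ s, ContinuousOn (f₄ s) (W.layer s X) := cr fun s => ((cγ s).mul (cj s)).mul (cl s)
  have c₅ : ∀ s, ContinuousOn (f₅ s) (W.layer s X) := cr fun s =>
    ((continuousOn_deriv_left (hW.smooth_γ₀ s X hX)).mul (cj s)).mul (cl s)
  have c₆ : ∀ s, ContinuousOn (f₆ s) (W.layer s X) := cr fun s =>
    ((cγ s).mul (continuousOn_deriv_left fun z hz =>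
      (hj.smooth s X hX z hz).of_le (by norm_num))).mul (cl s)
  set b : ℂ := Complex.I * k j X * A X Y with hb
  set c : ℂ := 2 * Complex.I * k j X * deriv (fun t => A t Y) X
    + Complex.I * ((deriv (k j) X : ℝ) : ℂ) * A X Y + iteratedDeriv 2 (A X) Y with hc
  have m : ∀ {f : Side → ℝ → ℂ} (a : ℂ), (∀ s, ContinuousOn (f s) (W.layer s X)) →
      ∀ s, ContinuousOn (fun z => a * f s z) (W.layer s X) := fun a hf s =>
    continuousOn_const.mul (hf s)
  have a₂ := continuousOn_layer_add (m (A X Y) c₁) (m (A X Y) c₂)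
  have a₃ := continuousOn_layer_add a₂ (m (A X Y) c₃)
  have a₄ := continuousOn_layer_add a₃ (m c c₄)
  have a₅ := continuousOn_layer_add a₄ (m b c₅)
  have split : W.depthIntegral (fun s z => W.source (k j) (φ j) A s X Y z * (φ l s X z : ℂ)) X
      = A X Y * W.depthIntegral f₁ X + A X Y * W.depthIntegral f₂ X + A X Y * W.depthIntegral f₃ X
        + c * W.depthIntegral f₄ X + b * W.depthIntegral f₅ X + 2 * b * W.depthIntegral f₆ X := by
    rw [← depthIntegral_const_mul, ← depthIntegral_const_mul, ← depthIntegral_const_mul,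
      ← depthIntegral_const_mul, ← depthIntegral_const_mul, ← depthIntegral_const_mul,
      ← depthIntegral_add hlt (m _ c₁) (m _ c₂), ← depthIntegral_add hlt a₂ (m _ c₃),
      ← depthIntegral_add hlt a₃ (m _ c₄), ← depthIntegral_add hlt a₄ (m _ c₅),
      ← depthIntegral_add hlt a₅ (m _ c₆)]
    refine depthIntegral_congr hlt fun s z _ => ?_
    simp only [source, f₁, f₂, f₃, f₄, f₅, f₆, hb, hc]
    push_cast
    ring
  have ibp : W.depthIntegral f₁ X
      = -(φ l .above X (W.h₀ X)
          * W.jump (fun s z => ((W.γ₁ s X Y z * deriv (φ j s X) z : ℝ) : ℂ)) X)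
        - W.depthIntegral (fun s z =>
          ((W.γ₁ s X Y z * deriv (φ j s X) z * deriv (φ l s X) z : ℝ) : ℂ)) X := by
    have h := depthIntegral_deriv_mul hlt
      (v := fun s z => ((W.γ₁ s X Y z * deriv (φ j s X) z : ℝ) : ℂ)) (w := fun s => φ l s X)
      (fun s z hz => (hγ₁φ s z hz).ofReal)
      (fun s z hz => (hl.contDiffAt hX s z hz).of_le (by norm_num))
    simp only [deriv_ofReal_comp (fun z => W.γ₁ _ X Y z * deriv (φ j _ X) z)] at h
    rw [show W.depthIntegral f₁ X = _ from h, hl.surface X hX, hj.bottom X hX]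
    simp only [jump, ← hl.continuous X hX]
    push_cast
    ring
  have hov := hj.deriv_overlap hI hW hl hX hδ
  -- Since `γ₀ φ_{jz}` is continuous at the interface, `φ_{jz}` jumps only through `1 / γ₀`; this
  -- yields the last term of `α`.
  have hflux : W.jump (fun s z => ((deriv (φ j s X) z : ℝ) : ℂ)) X
      = (W.γ₀ .above X (W.h₀ X) : ℂ) * ((deriv (φ j .above X) (W.h₀ X) : ℝ) : ℂ)
        * W.jump (fun s z => ((1 / W.γ₀ s X z : ℝ) : ℂ)) X := by
    have h1 := (hW.pos_γ₀ .above X hX _ (interface_mem_layer hlt .above)).ne'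
    have h2 := (hW.pos_γ₀ .below X hX _ (interface_mem_layer hlt .below)).ne'
    have h3 := hj.continuous_flux X hX
    simp only [jump]
    norm_cast
    field_simp
    linear_combination h3
  rw [fluxJump, valueJump, split, ibp, hδ X hX, hflux, Complex.ofReal_mul (W.γ₀ .above X (W.h₀ X))]
  simp only [α, C]
  -- The overlap identity replaces the integral of `γ₀_X φ_j φ_l` by `-C_{jl} - C_{lj}` plus a jump
  -- of `γ₀`. The former reduces `2 C_{jl}` to `C_{jl} - C_{lj}`; the latter cancels the `h₀_X` term
  -- of `fluxJump`.
  linear_combination b * hov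
end Waveguide
end

/-! ### Interface data, the transmission problem and a single component. -/

noncomputable section

namespace Waveguide
variable {W : Waveguide} {X : ℝ} {I : Set ℝ}

open Set

section SingleMode

variable {k : ℝ → ℝ} {φ : Side → ℝ → ℝ → ℝ} {A : ℝ → ℝ → ℂ}

theorem IsMode.continuousOn (hφ : W.IsMode I k φ) (hX : X ∈ I) (s : Side) :
    ContinuousOn (φ s X) (W.layer s X) :=
  continuousOn_of_contDiffAt fun z hz => (hφ.contDiffAt hX s z hz).of_le (by norm_num)

theorem continuousOn_source (hW : W.Regular I) (hφ : W.IsMode I k φ) (hX : X ∈ I) (Y : ℝ)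
    (s : Side) : ContinuousOn (W.source k φ A s X Y) (W.layer s X) := by
  have cφ := hφ.continuousOn hX s
  have cγ : ContinuousOn (W.γ₀ s X) (W.layer s X) :=
    continuousOn_of_contDiffAt (hW.contDiffAt_γ₀ hX s)
  have cγ₁ : ContinuousOn (W.γ₁ s X Y) (W.layer s X) :=
    continuousOn_of_contDiffAt (hW.smooth_γ₁ s X hX Y)
  have cn := hW.continuousOn_n₀ hX s
  have cν : ContinuousOn (W.ν s X Y) (W.layer s X) := fun z hz =>
    (hW.continuous_ν s X hX Y z hz).continuousWithinAt
  have cd : ContinuousOn (deriv fun t => W.γ₁ s X Y t * deriv (φ s X) t) (W.layer s X) :=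
    continuousOn_deriv_of_contDiffAt fun z hz =>
      (hW.smooth_γ₁ s X hX Y z hz).mul (hφ.contDiffAt hX s z hz).deriv_one
  have cγX := continuousOn_deriv_left (hW.smooth_γ₀ s X hX)
  have cφX := continuousOn_deriv_left fun z hz =>
    (hφ.smooth s X hX z hz).of_le (m := 1) (by norm_num)
  have cr : ∀ {f : ℝ → ℝ}, ContinuousOn f (W.layer s X) →
      ContinuousOn (fun z => (f z : ℂ)) (W.layer s X) := fun hf =>
    Complex.continuous_ofReal.comp_continuousOn hf
  unfold source
  refine (((((continuousOn_const.mul (cr cd)).add (continuousOn_const.mul (cr ?_))).add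
    (continuousOn_const.mul (((cr cγ).mul cν).mul (cr cφ)))).add
    (continuousOn_const.mul (cr (cγ.mul cφ)))).add
    (continuousOn_const.mul (cr (cγX.mul cφ)))).add (continuousOn_const.mul (cr (cγ.mul cφX)))
  exact (cγ₁.mul ((cn.pow 2).sub continuousOn_const)).mul cφ

theorem continuousOn_operator (hW : W.Regular I) (hX : X ∈ I) (κ : ℝ) {s : Side} {u : ℝ → ℂ}
    (hu : ∀ z ∈ W.layer s X, ContDiffAt ℝ 2 u z) :
    ContinuousOn (fun z => deriv (fun t => (W.γ₀ s X t : ℂ) * deriv u t) z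
      + ((W.γ₀ s X z * (W.n₀ s X z ^ 2 - κ ^ 2) : ℝ) : ℂ) * u z) (W.layer s X) := by
  refine ContinuousOn.add (continuousOn_deriv_of_contDiffAt fun z hz =>
    (hW.contDiffAt_γ₀ hX s z hz).ofReal.mul (hu z hz).deriv_one) (ContinuousOn.mul ?_ ?_)
  · exact Complex.continuous_ofReal.comp_continuousOn (hW.continuousOn_potential hX κ s)
  · exact continuousOn_of_contDiffAt fun z hz => (hu z hz).of_le (by norm_num)

/-- The interface condition for `P` at order `ε` prescribes the jump of `u₁`. -/
theorem trace_eq_iff {u : Side → Expansion} {Y : ℝ}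
    (hu : ∀ s, PowerSeries.coeff 0 (u s) = fun X Y z => A X Y * (φ s X z : ℂ)) :
    PowerSeries.coeff 1 (W.trace (u .above)) X Y = PowerSeries.coeff 1 (W.trace (u .below)) X Y ↔
      W.jump (fun s => PowerSeries.coeff 1 (u s) X Y) X = W.valueJump φ A X Y := by
  have h : ∀ s, deriv (fun z => A X Y * (φ s X z : ℂ)) (W.h₀ X)
      = A X Y * ((deriv (φ s X) (W.h₀ X) : ℝ) : ℂ) := fun s => by
    rw [deriv_const_mul_field, deriv_ofReal_comp]
  simp only [coeff_one_trace, hu, h, jump, valueJump]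
  constructor <;> intro e <;> linear_combination e

/-- The interface condition for the flux at order `ε` prescribes the jump of `γ₀ u_{1z}`. -/
theorem trace_flux_eq_iff (hW : W.Regular I) (hφ : W.IsMode I k φ) {θ : ℝ → ℝ} (hX : X ∈ I)
    (hθ : HasDerivAt θ (k X) X) {u : Side → Expansion} {Y : ℝ}
    (hu : ∀ s, PowerSeries.coeff 0 (u s) = fun X Y z => A X Y * (φ s X z : ℂ)) :
    PowerSeries.coeff 1 (W.trace (W.flux .above θ (u .above))) X Y
        = PowerSeries.coeff 1 (W.trace (W.flux .below θ (u .below))) X Y ↔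
      W.jump (fun s z => (W.γ₀ s X z : ℂ) * deriv (PowerSeries.coeff 1 (u s) X Y) z) X
        = W.fluxJump k φ A X Y := by
  have h : ∀ s z, deriv (fun z => A X Y * (φ s X z : ℂ)) z
      = A X Y * ((deriv (φ s X) z : ℝ) : ℂ) := fun s z => by
    rw [deriv_const_mul_field, deriv_ofReal_comp]
  have h' : ∀ s, deriv (PowerSeries.coeff 0 (W.flux s θ (u s)) X Y) (W.h₀ X)
      = A X Y * ((deriv (fun t => W.γ₀ s X t * deriv (φ s X) t) (W.h₀ X) : ℝ) : ℂ) := fun s => by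
    rw [coeff_zero_flux, hu, ← deriv_ofReal_comp, ← deriv_const_mul_field]
    congr 1
    funext t
    change (W.γ₀ s X t : ℂ) * deriv (fun z => A X Y * (φ s X z : ℂ)) t = _
    rw [h]
    push_cast
    ring
  simp only [coeff_one_trace, coeff_one_flux _ _ _ _ (hW.differentiable_h₀ X hX), h', hu, h,
    hθ.deriv, jump, fluxJump, ← hφ.continuous X hX]
  push_cast
  constructor <;> intro e <;> linear_combination e

/-- Otherwise the Cauchy data vanish at the surface, so `φ` vanishes in the upper layer by
uniqueness. Continuity of `φ` and `γ₀ φ_z` carries zero data across the interface, `φ` vanishes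
below too, and the normalization fails. -/
theorem IsMode.deriv_surface_ne_zero (hW : W.Regular I) (hφ : W.IsMode I k φ) (hX : X ∈ I) :
    deriv (φ .above X) 0 ≠ 0 := by
  intro h0
  have hlt := hW.interface X hX
  have key : ∀ (s : Side) (c : ℝ), (∃ a b, W.layer s X = Icc a b ∧ (c = a ∨ c = b)) →
      φ s X c = 0 → deriv (φ s X) c = 0 → ∀ z ∈ W.layer s X, φ s X z = 0 := by
    rintro s c ⟨a, b, hs, hc⟩ h1 h2
    have hγ := hW.contDiffAt_γ₀ hX s
    have hpos := hW.pos_γ₀ s X hX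
    have hq := hW.continuousOn_potential hX (k X) s
    have hφ2 := hφ.contDiffAt hX s
    have heq := hφ.spectral_layer hW hX s
    rw [hs] at hγ hpos hq hφ2 heq ⊢
    exact eqOn_zero_of_sturmLiouville hγ hpos hq hφ2 heq hc h1 h2
  have above := key .above 0 ⟨_, _, rfl, Or.inr rfl⟩ (hφ.surface X hX) h0
  have hm := interface_mem_layer hlt
  have hd : deriv (φ .above X) (W.h₀ X) = 0 := by
    have hcont : ContinuousOn (deriv (φ .above X)) (W.layer .above X) :=
      continuousOn_deriv_of_contDiffAt fun z hz =>
        (hφ.contDiffAt hX .above z hz).of_le (by norm_num)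
    have heq : EqOn (deriv (φ .above X)) (fun _ => 0) (W.openLayer .above X) := fun z hz => by
      have : φ .above X =ᶠ[nhds z] fun _ => 0 :=
        (isOpen_Ioo.eventually_mem hz).mono fun t ht =>
          above t (openLayer_subset_layer .above ht)
      rw [this.deriv_eq, deriv_const]
    exact heq.of_subset_closure hcont continuousOn_const (openLayer_subset_layer .above)
      (closure_openLayer hlt .above).ge (hm .above)
  have hd' : deriv (φ .below X) (W.h₀ X) = 0 := by
    have h := hφ.continuous_flux X hX
    rw [hd, mul_zero] at h
    exact (mul_eq_zero.1 h.symm).resolve_left (hW.pos_γ₀ .below X hX _ (hm .below)).ne'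
  have below := key .below (W.h₀ X) ⟨_, _, rfl, Or.inr rfl⟩
    ((hφ.continuous X hX).symm.trans (above _ (hm .above))) hd'
  have hn := hφ.normalized_depthIntegral hX
  rw [depthIntegral_congr (g := fun _ _ => 0) hlt] at hn
  · simp [depthIntegral] at hn
  · intro s z hz
    have : φ s X z = 0 := by
      cases s
      · exact above z (openLayer_subset_layer .above hz)
      · exact below z (openLayer_subset_layer .below hz)
    simp [this]

/-- The transmission problem with prescribed jumps, without the surface condition. -/
theorem exists_transmission (hW : W.Regular I) (hX : X ∈ I) (κ : ℝ) {g : Side → ℝ → ℂ}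
    (hg : ∀ s, ContinuousOn (g s) (W.layer s X)) (a b : ℂ) :
    ∃ u : Side → ℝ → ℂ, (∀ s, ∀ z ∈ W.layer s X, ContDiffAt ℝ 2 (u s) z) ∧
      deriv (u .below) (-W.H) = 0 ∧ W.jump u X = a ∧
      W.jump (fun s z => (W.γ₀ s X z : ℂ) * deriv (u s) z) X = b ∧
      ∀ s, ∀ z ∈ W.layer s X, deriv (fun t => (W.γ₀ s X t : ℂ) * deriv (u s) t) z
        + ((W.γ₀ s X z * (W.n₀ s X z ^ 2 - κ ^ 2) : ℝ) : ℂ) * u s z = g s z := by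
  have hlt := hW.interface X hX
  -- Shooting upwards from the bottom: zero flux there is the bottom condition, while the zero value
  -- is an arbitrary choice. The upper piece starts at the interface from the data of the lower one
  -- shifted by the prescribed jumps.
  obtain ⟨v, hv, -, hvp, hve⟩ := exists_sturmLiouville_initialValue hlt.1.le
    (hW.contDiffAt_γ₀ hX .below) (hW.pos_γ₀ .below X hX) (hW.continuousOn_potential hX κ .below)
    (hg .below) 0 0
  obtain ⟨w, hw, hw0, hwp, hwe⟩ := exists_sturmLiouville_initialValue hlt.2.le
    (hW.contDiffAt_γ₀ hX .above) (hW.pos_γ₀ .above X hX) (hW.continuousOn_potential hX κ .above)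
    (hg .above) (v (W.h₀ X) + a) (W.γ₀ .below X (W.h₀ X) * deriv v (W.h₀ X) + b)
  let u : Side → ℝ → ℂ := fun s => match s with
    | .above => w
    | .below => v
  refine ⟨u, ?_, ?_, ?_, ?_, ?_⟩
  · rintro (_ | _)
    exacts [hw, hv]
  · exact (mul_eq_zero.1 hvp).resolve_left (Complex.ofReal_ne_zero.2
      (hW.pos_γ₀ .below X hX _ (bottom_mem_layer hlt)).ne')
  · simp only [jump, u, hw0]
    ring
  · simp only [jump, u, hwp]
    ring
  · rintro (_ | _)
    exacts [hwe, hve]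

end SingleMode

section ModeFamily

variable {J : Finset ℕ} {ε : ℝ} {k : ℕ → ℝ → ℝ} {φ : ℕ → Side → ℝ → ℝ → ℝ} {θ : ℕ → ℝ → ℝ}
  {A : ℕ → ℝ → ℝ → ℂ}

variable (W) in
/-- The part of the `l`-th mode parabolic equation generated by the `j`-th amplitude, the phase
factor being divided out. -/
def coupling (k : ℕ → ℝ → ℝ) (φ : ℕ → Side → ℝ → ℝ → ℝ) (A : ℕ → ℝ → ℝ → ℂ) (l j : ℕ)
    (X Y : ℝ) : ℂ :=
  (if j = l then 1 else 0) * (2 * Complex.I * k j X * deriv (fun t => A j t Y) X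
      + Complex.I * ((deriv (k j) X : ℝ) : ℂ) * A j X Y + iteratedDeriv 2 (A j X) Y)
    + W.α k φ l j X Y * A j X Y

theorem exp_phase_mul (ε : ℝ) (a b : ℂ) :
    Complex.exp (Complex.I / ε * (a - b)) * Complex.exp (Complex.I / ε * b)
      = Complex.exp (Complex.I / ε * a) := by
  rw [← Complex.exp_add]
  ring_nf

/-- Factoring out `exp (i θ_l / ε)` leaves the relative phases `θ_{lj}`; the Kronecker delta in
`coupling` keeps the derivatives of the amplitude for `j = l` only. -/
theorem sum_coupling_mul_exp {l : ℕ} (hl : l ∈ J) (X Y : ℝ) :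
    ∑ j ∈ J, W.coupling k φ A l j X Y * Complex.exp (Complex.I / ε * θ j X)
      = W.mpe J ε θ k φ A l X Y * Complex.exp (Complex.I / ε * θ l X) := by
  rw [← Finset.add_sum_erase J _ hl, mpe, add_mul _ (∑ j ∈ J.erase l, _), Finset.sum_mul]
  congr 1
  · simp only [coupling, if_true]
    ring
  · refine Finset.sum_congr rfl fun j hj => ?_
    rw [mul_assoc, exp_phase_mul, coupling, if_neg (Finset.ne_of_mem_erase hj)]
    ring

theorem depthIntegral_overlap (hW : W.Regular I) (hmode : ∀ j ∈ J, W.IsMode I (k j) (φ j))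
    (hdistinct : ∀ X ∈ I, ∀ j ∈ J, ∀ l ∈ J, k j X = k l X → j = l) {j l : ℕ} (hj : j ∈ J)
    (hl : l ∈ J) : ∀ x ∈ I,
      W.depthIntegral (fun s z => ((W.γ₀ s x z * φ j s x z * φ l s x z : ℝ) : ℂ)) x
        = if j = l then 1 else 0 := by
  intro x hx
  split_ifs with h
  · subst h
    exact (hmode j hj).normalized_depthIntegral hx
  · exact (hmode j hj).orthogonal hW (hmode l hl) hx fun e => h (hdistinct x hx j hj l hl e)

/-- Projection on `φ_l` of the equation for the `j`-th component. -/
theorem depthIntegral_component_mul (hI : IsOpen I) (hW : W.Regular I)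
    (hmode : ∀ j ∈ J, W.IsMode I (k j) (φ j))
    (hdistinct : ∀ X ∈ I, ∀ j ∈ J, ∀ l ∈ J, k j X = k l X → j = l) {j l : ℕ} (hj : j ∈ J)
    (hl : l ∈ J) (hX : X ∈ I) (Y : ℝ) {u : Side → ℝ → ℂ}
    (hu : ∀ s, ∀ z ∈ W.layer s X, ContDiffAt ℝ 2 (u s) z) (hbot : deriv (u .below) (-W.H) = 0)
    (hval : W.jump u X = W.valueJump (φ j) (A j) X Y)
    (hflux : W.jump (fun s z => (W.γ₀ s X z : ℂ) * deriv (u s) z) X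
      = W.fluxJump (k j) (φ j) (A j) X Y) :
    W.depthIntegral (fun s z => (deriv (fun t => (W.γ₀ s X t : ℂ) * deriv (u s) t) z
        + ((W.γ₀ s X z * (W.n₀ s X z ^ 2 - k j X ^ 2) : ℝ) : ℂ) * u s z
        + W.source (k j) (φ j) (A j) s X Y z) * (φ l s X z : ℂ)) X
      = ((k l X : ℂ) ^ 2 - (k j X : ℂ) ^ 2)
          * W.depthIntegral (fun s z => (W.γ₀ s X z : ℂ) * u s z * (φ l s X z : ℂ)) X
        + W.coupling k φ A l j X Y
        - u .above 0 * ((W.γ₀ .above X 0 * deriv (φ l .above X) 0 : ℝ) : ℂ) := by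
  have h1 := (hmode l hl).green hW hX (k j X) hu hbot
  have h2 := depthIntegral_source_mul hI hW (hmode j hj) (hmode l hl)
    (depthIntegral_overlap hW hmode hdistinct hj hl) (A j) hX Y
  have cl := fun s => Complex.continuous_ofReal.comp_continuousOn ((hmode l hl).continuousOn hX s)
  have c₁ : ∀ s, ContinuousOn (fun z => (deriv (fun t => (W.γ₀ s X t : ℂ) * deriv (u s) t) z
      + ((W.γ₀ s X z * (W.n₀ s X z ^ 2 - k j X ^ 2) : ℝ) : ℂ) * u s z) * (φ l s X z : ℂ))
      (W.layer s X) := fun s => (continuousOn_operator hW hX (k j X) (hu s)).mul (cl s)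
  have c₂ : ∀ s, ContinuousOn (fun z => W.source (k j) (φ j) (A j) s X Y z * (φ l s X z : ℂ))
      (W.layer s X) := fun s => (continuousOn_source hW (hmode j hj) hX Y s).mul (cl s)
  simp only [add_mul _ (W.source _ _ _ _ _ _ _)]
  rw [depthIntegral_add (hW.interface X hX) c₁ c₂, h1, hval, hflux, coupling]
  linear_combination h2

end ModeFamily
end Waveguide
end

/-! ### Projection of the full problem and construction of a solution. -/

noncomputable section

namespace Waveguide
variable {W : Waveguide} {X : ℝ} {I : Set ℝ} {J : Finset ℕ} {ε : ℝ} {k : ℕ → ℝ → ℝ}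
  {φ : ℕ → Side → ℝ → ℝ → ℝ} {θ : ℕ → ℝ → ℝ} {A : ℕ → ℝ → ℝ → ℂ}

open Set

/-- Projection on `φ_l` of the Helmholtz equation at order `ε`. -/
theorem SolvesOrderOne.projection (hI : IsOpen I) (hW : W.Regular I)
    (hmode : ∀ j ∈ J, W.IsMode I (k j) (φ j))
    (hdistinct : ∀ X ∈ I, ∀ j ∈ J, ∀ l ∈ J, k j X = k l X → j = l)
    (hθ : ∀ j ∈ J, ∀ X ∈ I, HasDerivAt (θ j) (k j X) X)
    (hAX : ∀ j ∈ J, ∀ X ∈ I, ∀ Y, DifferentiableAt ℝ (fun t => A j t Y) X)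
    {u : ℕ → Side → Expansion} (hlead : HasLeadingTerm J φ A u) {r : Side → Fld}
    (hu : W.SolvesOrderOne I J ε θ r u) {l : ℕ} (hl : l ∈ J) (hX : X ∈ I) (Y : ℝ) :
    W.depthIntegral (fun s z => r s X Y z * (φ l s X z : ℂ)) X
      = (∑ j ∈ J, ((k l X : ℂ) ^ 2 - (k j X : ℂ) ^ 2) * W.B φ u j l X Y
          * Complex.exp (Complex.I / ε * θ j X))
        + W.mpe J ε θ k φ A l X Y * Complex.exp (Complex.I / ε * θ l X) := by
  have hlt := hW.interface X hX
  let v : ℕ → Side → ℝ → ℂ := fun j s => PowerSeries.coeff 1 (u j s) X Y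
  let L : ℕ → Side → ℝ → ℂ := fun j s z =>
    deriv (fun t => (W.γ₀ s X t : ℂ) * deriv (v j s) t) z
      + ((W.γ₀ s X z * (W.n₀ s X z ^ 2 - k j X ^ 2) : ℝ) : ℂ) * v j s z
      + W.source (k j) (φ j) (A j) s X Y z
  have hv : ∀ j ∈ J, ∀ s, ∀ z ∈ W.layer s X, ContDiffAt ℝ 2 (v j s) z := fun j hj s z hz =>
    hu.smooth j hj s X hX Y z hz
  have hL : ∀ j ∈ J, W.depthIntegral (fun s z => L j s z * (φ l s X z : ℂ)) X
      = ((k l X : ℂ) ^ 2 - (k j X : ℂ) ^ 2) * W.B φ u j l X Y + W.coupling k φ A l j X Y := by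
    intro j hj
    have hbot : deriv (v j .below) (-W.H) = 0 := by
      have h := hu.bottom j hj X hX Y
      rwa [coeff_termwise] at h
    have h := depthIntegral_component_mul hI hW hmode hdistinct hj hl hX Y (hv j hj) hbot
      ((trace_eq_iff (hlead j hj)).1 (hu.interface j hj X hX Y))
      ((trace_flux_eq_iff hW (hmode j hj) hX (hθ j hj X hX) (hlead j hj)).1
        (hu.interface_flux j hj X hX Y))
    rw [show v j .above 0 = 0 from hu.surface j hj X hX Y, zero_mul, sub_zero] at h
    exact h
  have hLc : ∀ j ∈ J, ∀ s, ContinuousOn (fun z => Complex.exp (Complex.I / ε * θ j X)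
      * (L j s z * (φ l s X z : ℂ))) (W.layer s X) := fun j hj s =>
    continuousOn_const.mul (((continuousOn_operator hW hX (k j X) (hv j hj s)).add
      (continuousOn_source hW (hmode j hj) hX Y s)).mul
      (Complex.continuous_ofReal.comp_continuousOn ((hmode l hl).continuousOn hX s)))
  rw [depthIntegral_congr (g := fun s z => ∑ j ∈ J, Complex.exp (Complex.I / ε * θ j X)
      * (L j s z * (φ l s X z : ℂ))) hlt, depthIntegral_sum hlt J hLc, ← sum_coupling_mul_exp hl,
    ← Finset.sum_add_distrib]
  · refine Finset.sum_congr rfl fun j hj => ?_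
    rw [depthIntegral_const_mul, hL j hj]
    ring
  · intro s z hz
    have hz' := openLayer_subset_layer s hz
    rw [← hu.equation s X hX Y z hz, Finset.sum_mul]
    refine Finset.sum_congr rfl fun j hj => ?_
    rw [coeff_one_helmholtz_of_leadingTerm hI hW (hmode j hj) (hθ j hj) hX (hAX j hj X hX Y)
      (hlead j hj s) hz' (hv j hj s z hz')]
    ring

/-- Projection on `φ_l` of the resonant terms. -/
theorem depthIntegral_resonantPart_mul (hW : W.Regular I)
    (hmode : ∀ j ∈ J, W.IsMode I (k j) (φ j))
    (hdistinct : ∀ X ∈ I, ∀ j ∈ J, ∀ l ∈ J, k j X = k l X → j = l) (u : ℕ → Side → Expansion)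
    {l : ℕ} (hl : l ∈ J) (hX : X ∈ I) (Y : ℝ) :
    W.depthIntegral (fun s z => W.resonantPart J ε θ k φ u s X Y z * (φ l s X z : ℂ)) X
      = ∑ j ∈ J, ((k l X : ℂ) ^ 2 - (k j X : ℂ) ^ 2) * W.B φ u j l X Y
          * Complex.exp (Complex.I / ε * θ j X) := by
  have hlt := hW.interface X hX
  let c : ℕ → ℂ := fun m => ∑ j ∈ J, ((k m X : ℂ) ^ 2 - (k j X : ℂ) ^ 2) * W.B φ u j m X Y
    * Complex.exp (Complex.I / ε * θ j X)
  have hc : ∀ m ∈ J, ∀ s, ContinuousOn (fun z => c m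
      * ((W.γ₀ s X z * φ m s X z * φ l s X z : ℝ) : ℂ)) (W.layer s X) := fun m hm s =>
    continuousOn_const.mul (Complex.continuous_ofReal.comp_continuousOn
      (((continuousOn_of_contDiffAt (hW.contDiffAt_γ₀ hX s)).mul
        ((hmode m hm).continuousOn hX s)).mul ((hmode l hl).continuousOn hX s)))
  rw [depthIntegral_congr (g := fun s z => ∑ m ∈ J, c m
      * ((W.γ₀ s X z * φ m s X z * φ l s X z : ℝ) : ℂ)) hlt, depthIntegral_sum hlt J hc]
  · rw [Finset.sum_eq_single_of_mem l hl fun m hm hml => ?_]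
    · rw [depthIntegral_const_mul, depthIntegral_overlap hW hmode hdistinct hl hl X hX, if_pos rfl,
        mul_one]
    · rw [depthIntegral_const_mul, depthIntegral_overlap hW hmode hdistinct hm hl X hX, if_neg hml,
        mul_zero]
  · intro s z _
    simp only [resonantPart, c, Finset.sum_mul]
    rw [Finset.sum_comm]
    refine Finset.sum_congr rfl fun m _ => Finset.sum_congr rfl fun j _ => ?_
    push_cast
    ring

/-- A component without resonant part, orthogonal to the other modes. -/
theorem exists_component (hI : IsOpen I) (hW : W.Regular I)
    (hmode : ∀ j ∈ J, W.IsMode I (k j) (φ j))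
    (hdistinct : ∀ X ∈ I, ∀ j ∈ J, ∀ l ∈ J, k j X = k l X → j = l)
    {j : ℕ} (hj : j ∈ J) (hX : X ∈ I) (Y : ℝ) :
    ∃ u : Side → ℝ → ℂ, (∀ s, ∀ z ∈ W.layer s X, ContDiffAt ℝ 2 (u s) z) ∧
      u .above 0 = 0 ∧ deriv (u .below) (-W.H) = 0 ∧
      W.jump u X = W.valueJump (φ j) (A j) X Y ∧
      W.jump (fun s z => (W.γ₀ s X z : ℂ) * deriv (u s) z) X
        = W.fluxJump (k j) (φ j) (A j) X Y ∧
      (∀ s, ∀ z ∈ W.layer s X, deriv (fun t => (W.γ₀ s X t : ℂ) * deriv (u s) t) z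
        + ((W.γ₀ s X z * (W.n₀ s X z ^ 2 - k j X ^ 2) : ℝ) : ℂ) * u s z
        + W.source (k j) (φ j) (A j) s X Y z
        = ∑ m ∈ J, W.coupling k φ A m j X Y * ((W.γ₀ s X z * φ m s X z : ℝ) : ℂ)) ∧
      ∀ l ∈ J, ((k l X : ℂ) ^ 2 - (k j X : ℂ) ^ 2)
        * W.depthIntegral (fun s z => (W.γ₀ s X z : ℂ) * u s z * (φ l s X z : ℂ)) X = 0 := by
  have hlt := hW.interface X hX
  have cγ : ∀ s, ContinuousOn (W.γ₀ s X) (W.layer s X) := fun s =>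
    continuousOn_of_contDiffAt (hW.contDiffAt_γ₀ hX s)
  -- By orthonormality the projection of `R` on each `φ_l` is exactly the coupling term produced by
  -- the source and the interface data, so in the projected equation the two cancel.
  let R : Side → ℝ → ℂ := fun s z =>
    ∑ m ∈ J, W.coupling k φ A m j X Y * ((W.γ₀ s X z * φ m s X z : ℝ) : ℂ)
  have hR : ∀ s, ContinuousOn (R s) (W.layer s X) := fun s =>
    continuousOn_finsetSum _ fun m hm => continuousOn_const.mul
      (Complex.continuous_ofReal.comp_continuousOn ((cγ s).mul ((hmode m hm).continuousOn hX s)))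
  obtain ⟨u, hu, hbot, hval, hflux, heq⟩ := exists_transmission hW hX (k j X)
    (g := fun s z => R s z - W.source (k j) (φ j) (A j) s X Y z)
    (fun s => (hR s).sub (continuousOn_source hW (hmode j hj) hX Y s))
    (W.valueJump (φ j) (A j) X Y) (W.fluxJump (k j) (φ j) (A j) X Y)
  have heq' : ∀ s, ∀ z ∈ W.layer s X, deriv (fun t => (W.γ₀ s X t : ℂ) * deriv (u s) t) z
      + ((W.γ₀ s X z * (W.n₀ s X z ^ 2 - k j X ^ 2) : ℝ) : ℂ) * u s z
      + W.source (k j) (φ j) (A j) s X Y z = R s z := fun s z hz => by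
    rw [heq s z hz, sub_add_cancel]
  have hproj : ∀ l ∈ J, ((k l X : ℂ) ^ 2 - (k j X : ℂ) ^ 2)
      * W.depthIntegral (fun s z => (W.γ₀ s X z : ℂ) * u s z * (φ l s X z : ℂ)) X
      = u .above 0 * ((W.γ₀ .above X 0 * deriv (φ l .above X) 0 : ℝ) : ℂ) := by
    intro l hl
    have h := depthIntegral_component_mul hI hW hmode hdistinct hj hl hX Y hu hbot hval hflux
    have hc : ∀ m ∈ J, ∀ s, ContinuousOn (fun z => W.coupling k φ A m j X Y
        * ((W.γ₀ s X z * φ m s X z * φ l s X z : ℝ) : ℂ)) (W.layer s X) := fun m hm s =>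
      continuousOn_const.mul (Complex.continuous_ofReal.comp_continuousOn
        (((cγ s).mul ((hmode m hm).continuousOn hX s)).mul ((hmode l hl).continuousOn hX s)))
    rw [depthIntegral_congr (g := fun s z => ∑ m ∈ J, W.coupling k φ A m j X Y
        * ((W.γ₀ s X z * φ m s X z * φ l s X z : ℝ) : ℂ)) hlt (fun s z hz => by
          rw [heq' s z (openLayer_subset_layer s hz)]
          simp only [R, Finset.sum_mul]
          refine Finset.sum_congr rfl fun m _ => ?_
          push_cast
          ring), depthIntegral_sum hlt J hc,
      Finset.sum_eq_single_of_mem l hl fun m hm hml => by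
        rw [depthIntegral_const_mul, depthIntegral_overlap hW hmode hdistinct hm hl X hX,
          if_neg hml, mul_zero], depthIntegral_const_mul,
      depthIntegral_overlap hW hmode hdistinct hl hl X hX, if_pos rfl] at h
    linear_combination -h
  -- For `l = j` the factor `k_l² - k_j²` vanishes, which forces the surface value to be zero.
  have hsurf : u .above 0 = 0 := by
    have h := hproj j hj
    rw [sub_self, zero_mul] at h
    exact (mul_eq_zero.1 h.symm).resolve_right (Complex.ofReal_ne_zero.2
      (mul_ne_zero (hW.pos_γ₀ .above X hX 0 (surface_mem_layer hlt)).ne'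
        ((hmode j hj).deriv_surface_ne_zero hW hX)))
  refine ⟨u, hu, hsurf, hbot, hval, hflux, heq', fun l hl => ?_⟩
  rw [hproj l hl, hsurf, zero_mul]

/-- The mode parabolic equations suffice for solvability with the resonant terms omitted. -/
theorem exists_solvesOrderOne (hI : IsOpen I) (hW : W.Regular I)
    (hmode : ∀ j ∈ J, W.IsMode I (k j) (φ j))
    (hdistinct : ∀ X ∈ I, ∀ j ∈ J, ∀ l ∈ J, k j X = k l X → j = l)
    (hθ : ∀ j ∈ J, ∀ X ∈ I, HasDerivAt (θ j) (k j X) X)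
    (hAX : ∀ j ∈ J, ∀ X ∈ I, ∀ Y, DifferentiableAt ℝ (fun t => A j t Y) X)
    (hmpe : ∀ l ∈ J, ∀ X ∈ I, ∀ Y, W.mpe J ε θ k φ A l X Y = 0) :
    ∃ u : ℕ → Side → Expansion, HasLeadingTerm J φ A u ∧
      W.SolvesOrderOne I J ε θ (W.resonantPart J ε θ k φ u) u := by
  -- The components may be chosen separately for each `(X, Y)`: at this order `u₁` is differentiated
  -- in `z` only.
  have hex := fun j (hj : j ∈ J) X (hX : X ∈ I) Y =>
    exists_component (A := A) hI hW hmode hdistinct hj hX Y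
  choose! V hV using hex
  let u : ℕ → Side → Expansion := fun j s =>
    PowerSeries.C (fun X Y z => A j X Y * (φ j s X z : ℂ) : Fld)
      + PowerSeries.X * PowerSeries.C (fun X Y z => V j X Y s z : Fld)
  have hu0 : ∀ j s, PowerSeries.coeff 0 (u j s) = fun X Y z => A j X Y * (φ j s X z : ℂ) :=
    fun j s => by simp [u]
  have hu1 : ∀ j s, PowerSeries.coeff 1 (u j s) = fun X Y z => V j X Y s z := fun j s => by
    simp only [u, map_add, coeff_one_X_mul]
    simp [PowerSeries.coeff_C]
  refine ⟨u, fun j _ s => hu0 j s, ?_, ?_, ?_, ?_, ?_, ?_⟩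
  · intro j hj s X hX Y z hz
    rw [hu1]
    exact (hV j hj X hX Y).1 s z hz
  · intro s X hX Y z hz
    have hz' := openLayer_subset_layer s hz
    -- The constructed components have no resonant part, so they solve the problem with zero
    -- right-hand side.
    have hres : W.resonantPart J ε θ k φ u s X Y z = 0 := by
      refine Finset.sum_eq_zero fun j hj => ?_
      rw [Finset.sum_eq_zero fun l hl => ?_, zero_mul]
      have h := (hV j hj X hX Y).2.2.2.2.2.2 l hl
      simp only [B, hu1, h, zero_mul]
    rw [hres]
    have hcomp : ∀ j ∈ J,
        PowerSeries.coeff 1 (helmholtz (W.γ s) (W.κsq s) (θ j) (u j s)) X Y z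
          = ∑ m ∈ J, W.coupling k φ A m j X Y * ((W.γ₀ s X z * φ m s X z : ℝ) : ℂ) := fun j hj => by
      rw [coeff_one_helmholtz_of_leadingTerm hI hW (hmode j hj) (hθ j hj) hX (hAX j hj X hX Y)
        (hu0 j s) hz' (by rw [hu1]; exact (hV j hj X hX Y).1 s z hz')]
      simp only [hu1]
      exact (hV j hj X hX Y).2.2.2.2.2.1 s z hz'
    calc ∑ j ∈ J, PowerSeries.coeff 1 (helmholtz (W.γ s) (W.κsq s) (θ j) (u j s)) X Y z
          * Complex.exp (Complex.I / ε * θ j X)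
        = ∑ j ∈ J, ∑ m ∈ J, W.coupling k φ A m j X Y * Complex.exp (Complex.I / ε * θ j X)
            * ((W.γ₀ s X z * φ m s X z : ℝ) : ℂ) := by
          refine Finset.sum_congr rfl fun j hj => ?_
          rw [hcomp j hj, Finset.sum_mul]
          exact Finset.sum_congr rfl fun m _ => by ring
      _ = 0 := by
          -- Individual right-hand sides need not vanish. After exchanging the sums, the coefficient
          -- of each `γ₀ φ_m` is the `m`-th parabolic equation times its phase.
          rw [Finset.sum_comm]
          refine Finset.sum_eq_zero fun m hm => ?_
          rw [← Finset.sum_mul, sum_coupling_mul_exp hm, hmpe m hm X hX Y, zero_mul, zero_mul]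
  · intro j hj X hX Y
    rw [hu1]
    exact (hV j hj X hX Y).2.1
  · intro j hj X hX Y
    rw [coeff_termwise, hu1]
    exact (hV j hj X hX Y).2.2.1
  · intro j hj X hX Y
    rw [trace_eq_iff (hu0 j)]
    simp only [hu1]
    exact (hV j hj X hX Y).2.2.2.1
  · intro j hj X hX Y
    rw [trace_flux_eq_iff hW (hmode j hj) hX (hθ j hj X hX) (hu0 j)]
    simp only [hu1]
    exact (hV j hj X hX Y).2.2.2.2.1

end Waveguide
end

/-! ### The mode parabolic equations. -/

theorem proposition1 (W : Waveguide) (I : Set ℝ) (hI : IsOpen I) (hW : W.Regular I)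
    (M N : ℕ) (ε : ℝ) (hε : 0 < ε)
    (k : ℕ → ℝ → ℝ) (φ : ℕ → Side → ℝ → ℝ → ℝ)
    (hmode : ∀ j ∈ Finset.Icc M N, W.IsMode I (k j) (φ j))
    (hdistinct : ∀ X ∈ I, ∀ j ∈ Finset.Icc M N, ∀ l ∈ Finset.Icc M N, k j X = k l X → j = l)
    (hresonant : ∀ X ∈ I, ∀ j ∈ Finset.Icc M N, ∀ l ∈ Finset.Icc M N, |k l X - k j X| < ε)
    (θ : ℕ → ℝ → ℝ) (hθ : ∀ j ∈ Finset.Icc M N, ∀ X ∈ I, HasDerivAt (θ j) (k j X) X)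
    (A : ℕ → ℝ → ℝ → ℂ)
    (hAX : ∀ j ∈ Finset.Icc M N, ∀ X ∈ I, ∀ Y, DifferentiableAt ℝ (fun t => A j t Y) X)
    (hAY : ∀ j ∈ Finset.Icc M N, ∀ X ∈ I, ContDiff ℝ 2 (A j X)) :
    -- every solution of the problem at order `ε` satisfies the mode parabolic equations
    -- up to the resonant terms, which are `O(ε)`
    (∀ u : ℕ → Side → Expansion, Waveguide.HasLeadingTerm (Finset.Icc M N) φ A u →
      W.SolvesOrderOne I (Finset.Icc M N) ε θ 0 u →
      ∀ l ∈ Finset.Icc M N, ∀ X ∈ I, ∀ Y : ℝ,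
        W.mpe (Finset.Icc M N) ε θ k φ A l X Y
          = - ∑ j ∈ (Finset.Icc M N).erase l, ((k l X : ℂ) ^ 2 - (k j X : ℂ) ^ 2)
              * W.B φ u j l X Y * Complex.exp (Complex.I / ε * (θ j X - θ l X)) ∧
        ‖W.mpe (Finset.Icc M N) ε θ k φ A l X Y‖
          ≤ ε * ∑ j ∈ (Finset.Icc M N).erase l, (k l X + k j X) * ‖W.B φ u j l X Y‖) ∧
    -- with the resonant terms omitted, the problem at order `ε` is solvable
    -- if and only if the mode parabolic equations hold
    ((∃ u : ℕ → Side → Expansion, Waveguide.HasLeadingTerm (Finset.Icc M N) φ A u ∧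
        W.SolvesOrderOne I (Finset.Icc M N) ε θ
          (W.resonantPart (Finset.Icc M N) ε θ k φ u) u) ↔
      ∀ l ∈ Finset.Icc M N, ∀ X ∈ I, ∀ Y : ℝ,
        W.mpe (Finset.Icc M N) ε θ k φ A l X Y = 0) := by
  have hexp : ∀ a : ℂ, Complex.exp a ≠ 0 := Complex.exp_ne_zero
  refine ⟨fun u hlead hu l hl X hX Y => ?_, ⟨?_, fun h => ?_⟩⟩
  · have h := hu.projection hI hW hmode hdistinct hθ hAX hlead hl hX Y
    have h0 : W.depthIntegral (fun s z => (0 : Side → Fld) s X Y z * (φ l s X z : ℂ)) X = 0 := by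
      simp [Waveguide.depthIntegral]
    rw [h0, ← Finset.add_sum_erase _ _ hl, sub_self, zero_mul, zero_mul, zero_add] at h
    have hmpe : W.mpe (Finset.Icc M N) ε θ k φ A l X Y
        = - ∑ j ∈ (Finset.Icc M N).erase l, ((k l X : ℂ) ^ 2 - (k j X : ℂ) ^ 2)
            * W.B φ u j l X Y * Complex.exp (Complex.I / ε * (θ j X - θ l X)) := by
      refine mul_right_cancel₀ (hexp (Complex.I / ε * θ l X)) ?_
      rw [neg_mul, Finset.sum_mul, eq_neg_iff_add_eq_zero, add_comm, h]
      simp only [mul_assoc, Waveguide.exp_phase_mul]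
    refine ⟨hmpe, ?_⟩
    rw [hmpe, norm_neg, Finset.mul_sum]
    refine (norm_sum_le _ _).trans (Finset.sum_le_sum fun j hj => ?_)
    have hj' := Finset.mem_of_mem_erase hj
    have hphase : ‖Complex.exp (Complex.I / ε * (θ j X - θ l X))‖ = 1 := by
      rw [show Complex.I / ε * (θ j X - θ l X) = (((θ j X - θ l X) / ε : ℝ) : ℂ) * Complex.I by
        push_cast; ring]
      exact Complex.norm_exp_ofReal_mul_I _
    have hk : ‖(k l X : ℂ) ^ 2 - (k j X : ℂ) ^ 2‖ ≤ ε * (k l X + k j X) := by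
      have h1 := (hmode l hl).pos X hX
      have h2 := (hmode j hj').pos X hX
      rw [show (k l X : ℂ) ^ 2 - (k j X : ℂ) ^ 2 = (((k l X - k j X) * (k l X + k j X) : ℝ) : ℂ) by
        push_cast; ring, Complex.norm_real, norm_mul, Real.norm_eq_abs, Real.norm_eq_abs,
        abs_of_pos (add_pos h1 h2)]
      exact mul_le_mul_of_nonneg_right (hresonant X hX j hj' l hl).le (add_pos h1 h2).le
    rw [norm_mul, norm_mul, hphase, mul_one, ← mul_assoc]
    exact mul_le_mul_of_nonneg_right hk (norm_nonneg _)
  · rintro ⟨u, hlead, hu⟩ l hl X hX Y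
    have h := hu.projection hI hW hmode hdistinct hθ hAX hlead hl hX Y
    -- The resonant sum now occurs on both sides of the projected equation and cancels.
    rw [Waveguide.depthIntegral_resonantPart_mul hW hmode hdistinct u hl hX Y, left_eq_add] at h
    exact (mul_eq_zero.1 h).resolve_right (hexp _)
  · exact Waveguide.exists_solvesOrderOne hI hW hmode hdistinct hθ hAX h
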